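/- Let $K$ be a nonempty locally compact Hausdorff space, $M(K)$ the space of regular complex Borel measures on $K$, $M^+(K)$ its cone of non-negative measures with the cone topology (the weakest topology making $\mu\mapsto\mu(K)$ and $\mu\mapsto\int f\,d\mu$, $0\le f\in C_c(K)$, continuous), and $p_x$ the point mass at $x$. Let $(K,*)$ be a semitopological semihypergroup: $*$ is an associative bilinear product on $M(K)$ that maps $M^+(K)\times M^+(K)$ into $M^+(K)$ and is separately continuous there; for all $x,y\in K$ the measure $p_x*p_y$ is a probability measure with compact support; and $(x,y)\mapsto\operatorname{supp}(p_x*p_y)$ is continuous from $K\times K$ into the compact subsets of $K$ with the Michael (Vietoris) topology. Put $L_xf(y)=\int_K f\,d(p_x*p_y)$. Let $AP(K)$ be the space of those bounded continuous $f:K\to\mathbb C$ for which $\{L_xf:x\in K\}$ is relatively compact in the space of bounded continuous functions with the supremum norm. $AP(K)$ is called left amenable if there is $m\in AP(K)^*$ with $\|m\|=m(1)=1$ and $m(L_xf)=m(f)$ for all $x\in K$, $f\in AP(K)$ (where $L_xf\in AP(K)$). Let $X$ be a complex Banach space and give $X^*$ the weak$^*$ topology. An action of $K$ on $X^*$ is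 a map $\pi:K\times X^*\to X^*$, $\pi_s:=\pi(s,\cdot)$, such that $\pi(s,\pi(t,u))=\int_K\pi(\zeta,u)\,d(p_s*p_t)(\zeta)$ for all $s,t\in K$, $u\in X^*$ (the integral being taken weak$^*$, i.e. after evaluation at each $\varphi\in X$), and $\pi(e,u)=u$ for all $u$ whenever $e$ is a two-sided identity of $K$. It is separately continuous if it is so for the weak$^*$ topology; affine if every $\pi_s$ preserves convex combinations; and equicontinuous if for every weak$^*$-compact $C\subseteq X^*$, every $x\in C$ and every weak$^*$-neighbourhood $U$ of $0$ there is a weak$^*$-neighbourhood $V$ of $0$ such that $\pi(s,y)-\pi(s,x)\in U$ for all $s\in K$ and all $y\in C$ with $y-x\in V$. Theorem. $AP(K)$ is left amenable if and only if every separately continuous, equicontinuous, affine action $\pi$ of $K$ on a dual Banach space $X^*$ for which there is $\omega_0\in X^*$ with $\{\pi(s,\omega_0):s\in K\}$ norm bounded has a common fixed point, i.e. a point $x_0\in X^*$ with $\pi(s,x_0)=x_0$ for all $s\in K$. -/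

import Mathlib

open MeasureTheory Topology
open scoped Pointwise NNReal ENNReal BoundedContinuousFunction

universe u v

/-! ### Regular complex measures -/

theorem SHG.regular_of_le {K : Type*} [TopologicalSpace K] [T2Space K] [MeasurableSpace K]
    [BorelSpace K] {ρ ν : Measure K} [IsFiniteMeasure ν] [ν.InnerRegularCompactLTTop]
    (h : ρ ≤ ν) : ρ.Regular := by
  have : IsFiniteMeasure ρ := isFiniteMeasure_of_le ν h
  have : ρ.InnerRegularCompactLTTop := by
    refine ⟨fun A hA r hr => ?_⟩
    obtain ⟨C, hCA, hC, hlt⟩ := hA.1.exists_isCompact_sdiff_lt (measure_ne_top ν A)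
      (tsub_pos_of_lt hr).ne'
    refine ⟨C, hCA, hC, ?_⟩
    by_contra! hle
    have h1 : ρ A ≤ ρ C + ρ (A \ C) := by
      calc ρ A ≤ ρ (C ∪ A \ C) := measure_mono (by simp)
        _ ≤ _ := measure_union_le _ _
    have h2 : ρ (A \ C) < ρ A - r := (h _).trans_lt hlt
    have h3 : r + ρ (A \ C) < r + (ρ A - r) :=
      ENNReal.add_lt_add_left (hr.trans_le le_top).ne h2
    rw [add_tsub_cancel_of_le hr.le] at h3
    exact absurd (h1.trans (add_le_add_left hle _)) (not_le.mpr h3)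
  infer_instance

theorem SHG.isFiniteMeasure_variation {K : Type*} [MeasurableSpace K] (μ : ComplexMeasure K) :
    IsFiniteMeasure μ.variation := by
  have h : μ.variation ≤ (ComplexMeasure.re μ).totalVariation
      + (ComplexMeasure.im μ).totalVariation := by
    refine VectorMeasure.variation_le_of_forall_enorm_le fun E _ => ?_
    have h1 := SignedMeasure.enorm_le_totalVariation (ComplexMeasure.re μ) E
    have h2 := SignedMeasure.enorm_le_totalVariation (ComplexMeasure.im μ) E
    rw [Measure.add_apply]
    refine le_trans ?_ (add_le_add h1 h2)
    have h3 : μ E = (((ComplexMeasure.re μ E : ℝ) : ℂ))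
        + ((ComplexMeasure.im μ E : ℝ) : ℂ) * Complex.I := by
      exact (Complex.re_add_im (μ E)).symm
    rw [h3]
    refine (enorm_add_le _ _).trans ?_
    simp [← ofReal_norm]
  have h4 : IsFiniteMeasure ((ComplexMeasure.re μ).totalVariation
      + (ComplexMeasure.im μ).totalVariation) := by
    unfold SignedMeasure.totalVariation
    infer_instance
  exact isFiniteMeasure_of_le _ h

/-- `M(K)`: the space of regular complex Borel measures on `K`, i.e. of the complex measures whose
total variation is a regular measure. -/
noncomputable def RegularComplexMeasure (K : Type*) [TopologicalSpace K] [T2Space K]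
    [MeasurableSpace K] [BorelSpace K] : Submodule ℂ (ComplexMeasure K) where
  carrier := {μ | μ.variation.Regular}
  zero_mem' := by
    change (0 : ComplexMeasure K).variation.Regular
    rw [VectorMeasure.variation_zero]
    infer_instance
  add_mem' := by
    intro μ ν hμ hν
    have : μ.variation.Regular := hμ
    have : ν.variation.Regular := hν
    have := SHG.isFiniteMeasure_variation μ
    have := SHG.isFiniteMeasure_variation ν
    exact SHG.regular_of_le (ν := μ.variation + ν.variation) VectorMeasure.variation_add_le
  smul_mem' := by
    intro c μ hμ
    have : μ.variation.Regular := hμ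
    change (c • μ).variation.Regular
    rw [VectorMeasure.variation_smul]
    infer_instance

/-- The point mass `p_x`. -/
noncomputable def pointMass {K : Type*} [TopologicalSpace K] [T2Space K]
    [MeasurableSpace K] [BorelSpace K] (x : K) : RegularComplexMeasure K :=
  ⟨VectorMeasure.dirac x 1, by
    change (VectorMeasure.dirac x (1 : ℂ)).variation.Regular
    rw [VectorMeasure.variation_dirac]
    have : (Measure.dirac x).InnerRegularCompactLTTop := by
      refine ⟨fun A hA r hr => ?_⟩
      by_cases hx : x ∈ A
      · refine ⟨{x}, by simpa using hx, isCompact_singleton, ?_⟩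
        have h1 := Measure.dirac_apply_of_mem hx
        rw [h1] at hr
        simpa using hr
      · rw [Measure.dirac_apply' _ hA.1] at hr
        simp [hx] at hr
    have : (Measure.dirac x).Regular := inferInstance
    simpa using this⟩

/-- A complex measure is non-negative if it takes real values `≥ 0`. -/
def IsNonnegMeasure {K : Type*} [MeasurableSpace K] (μ : ComplexMeasure K) : Prop :=
  ∀ A : Set K, MeasurableSet A → 0 ≤ (μ A).re ∧ (μ A).im = 0

theorem isNonnegMeasure_pointMass {K : Type*} [TopologicalSpace K] [T2Space K]
    [MeasurableSpace K] [BorelSpace K] (x : K) :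
    IsNonnegMeasure (pointMass x : ComplexMeasure K) := by
  intro A hA
  by_cases hx : x ∈ A
  · have h : (pointMass x : ComplexMeasure K) A = 1 := VectorMeasure.dirac_apply_of_mem hA hx
    simp [h]
  · have h : (pointMass x : ComplexMeasure K) A = 0 := VectorMeasure.dirac_apply_of_notMem hx
    simp [h]

/-- `M⁺(K)`: the finite non-negative regular Borel measures on `K`, as elements of `M(K)`. -/
structure PositiveRegularMeasure (K : Type*) [TopologicalSpace K] [T2Space K]
    [MeasurableSpace K] [BorelSpace K] where
  val : RegularComplexMeasure K
  nonneg : IsNonnegMeasure (val : ComplexMeasure K)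

/-- A non-negative complex measure agrees with its total variation; so for such measures the total
variation is just the same measure, seen as a Mathlib `Measure`. -/
theorem IsNonnegMeasure.variation_apply {K : Type*} [MeasurableSpace K] {μ : ComplexMeasure K}
    (h : IsNonnegMeasure μ) {A : Set K} (hA : MeasurableSet A) :
    μ.variation A = ENNReal.ofReal (μ A).re := by
  have hnorm : ∀ E, MeasurableSet E → ‖μ E‖ₑ = ENNReal.ofReal (μ E).re := by
    intro E hE
    have h1 : μ E = (((μ E).re : ℝ) : ℂ) := Complex.ext (by simp) (by simp [(h E hE).2])
    rw [h1, ← ofReal_norm, Complex.norm_real, Real.norm_of_nonneg (h E hE).1, Complex.ofReal_re]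
  apply le_antisymm
  · have h0 : VectorMeasure.restrict (0 : SignedMeasure K) Set.univ
        ≤ VectorMeasure.restrict (ComplexMeasure.re μ) Set.univ := by
      refine VectorMeasure.restrict_le_restrict_of_subset_le _ _ fun E hE _ => ?_
      exact (h E hE).1
    let m : Measure K := (ComplexMeasure.re μ).toMeasureOfZeroLE Set.univ MeasurableSet.univ h0
    have hm : ∀ E, MeasurableSet E → m E = ENNReal.ofReal (μ E).re := by
      intro E hE
      simp only [m]
      rw [SignedMeasure.toMeasureOfZeroLE_apply _ _ _ hE]
      simp [ENNReal.ofReal, Real.toNNReal, max_eq_left (h E hE).1]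
      rfl
    rw [← hm A hA]
    exact VectorMeasure.variation_apply_le_of_forall_enorm_le hA
      fun E hE _ => by rw [hnorm E hE, hm E hE]
  · rw [← hnorm A hA]
    exact VectorMeasure.enorm_measure_le_variation μ A

/-- A non-negative element of `M(K)` as a Mathlib measure. -/
noncomputable def PositiveRegularMeasure.toMeasure {K : Type*} [TopologicalSpace K] [T2Space K]
    [MeasurableSpace K] [BorelSpace K] (μ : PositiveRegularMeasure K) : Measure K :=
  (μ.val : ComplexMeasure K).variation

/-- The cone topology on `M⁺(K)`: the weakest topology for which `μ ↦ ∫ f dμ` is continuous for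
each continuous `f ≥ 0` with compact support and `μ ↦ μ(K)` is continuous. -/
noncomputable instance PositiveRegularMeasure.instTopologicalSpace {K : Type*}
    [TopologicalSpace K] [T2Space K] [MeasurableSpace K] [BorelSpace K] :
    TopologicalSpace (PositiveRegularMeasure K) :=
  TopologicalSpace.induced
    (fun μ : PositiveRegularMeasure K =>
      ((fun f : CompactlySupportedContinuousMap K ℝ≥0 => ∫ x, (f x : ℝ) ∂μ.toMeasure),
        μ.toMeasure.real Set.univ))
    (inferInstance : TopologicalSpace ((CompactlySupportedContinuousMap K ℝ≥0 → ℝ) × ℝ))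

/-! ### Semitopological semihypergroups -/

/-- A semitopological semihypergroup structure on a locally compact Hausdorff space `K`: an
associative bilinear product (convolution) on `M(K)` which is positive and separately continuous on
`M⁺(K)`, such that `p_x * p_y` is a probability measure with compact support, and such that
`(x, y) ↦ supp (p_x * p_y)` is continuous into the compact subsets of `K` with the Michael
(Vietoris) topology. -/
structure SemitopologicalSemihypergroup (K : Type*) [TopologicalSpace K] [T2Space K]
    [LocallyCompactSpace K] [MeasurableSpace K] [BorelSpace K] where
  conv : RegularComplexMeasure K →ₗ[ℂ] RegularComplexMeasure K →ₗ[ℂ] RegularComplexMeasure K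
  conv_assoc : ∀ μ ν ω, conv (conv μ ν) ω = conv μ (conv ν ω)
  conv_nonneg : ∀ μ ν : PositiveRegularMeasure K,
    IsNonnegMeasure (conv μ.val ν.val : ComplexMeasure K)
  continuous_conv_left : ∀ ω : PositiveRegularMeasure K,
    Continuous fun μ : PositiveRegularMeasure K =>
      PositiveRegularMeasure.mk (conv ω.val μ.val) (conv_nonneg ω μ)
  continuous_conv_right : ∀ ω : PositiveRegularMeasure K,
    Continuous fun μ : PositiveRegularMeasure K =>
      PositiveRegularMeasure.mk (conv μ.val ω.val) (conv_nonneg μ ω)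
  conv_pointMass_univ : ∀ x y : K,
    (conv (pointMass x) (pointMass y) : ComplexMeasure K) Set.univ = 1
  isCompact_support : ∀ x y : K,
    IsCompact (conv (pointMass x) (pointMass y) : ComplexMeasure K).variation.support
  continuous_support : Continuous fun p : K × K =>
    (⟨(conv (pointMass p.1) (pointMass p.2) : ComplexMeasure K).variation.support,
      isCompact_support p.1 p.2⟩ : TopologicalSpace.Compacts K)

namespace SemitopologicalSemihypergroup

theorem nonneg_conv_pointMass {K : Type*} [TopologicalSpace K] [T2Space K]
    [LocallyCompactSpace K] [MeasurableSpace K] [BorelSpace K]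
    (S : SemitopologicalSemihypergroup K) (x y : K) :
    IsNonnegMeasure (S.conv (pointMass x) (pointMass y) : ComplexMeasure K) :=
  S.conv_nonneg ⟨pointMass x, isNonnegMeasure_pointMass x⟩ ⟨pointMass y, isNonnegMeasure_pointMass y⟩

/-- The probability measure `p_x * p_y`. -/
noncomputable def convMeasure {K : Type*} [TopologicalSpace K] [T2Space K]
    [LocallyCompactSpace K] [MeasurableSpace K] [BorelSpace K]
    (S : SemitopologicalSemihypergroup K) (x y : K) : Measure K :=
  PositiveRegularMeasure.toMeasure
    ⟨S.conv (pointMass x) (pointMass y), S.nonneg_conv_pointMass x y⟩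

instance {K : Type*} [TopologicalSpace K] [T2Space K]
    [LocallyCompactSpace K] [MeasurableSpace K] [BorelSpace K]
    (S : SemitopologicalSemihypergroup K) (x y : K) : IsProbabilityMeasure (S.convMeasure x y) where
  measure_univ := by
    have h := (S.nonneg_conv_pointMass x y).variation_apply MeasurableSet.univ
    rw [S.conv_pointMass_univ] at h
    simpa [convMeasure, PositiveRegularMeasure.toMeasure] using h

/-- `e` is a two-sided identity: `p_x * p_e = p_e * p_x = p_x` for every `x`. -/
def IsTwoSidedIdentity {K : Type*} [TopologicalSpace K] [T2Space K]
    [LocallyCompactSpace K] [MeasurableSpace K] [BorelSpace K]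
    (S : SemitopologicalSemihypergroup K) (e : K) : Prop :=
  ∀ x : K, S.conv (pointMass x) (pointMass e) = pointMass x ∧
    S.conv (pointMass e) (pointMass x) = pointMass x

/-- The left translate `L_x f (y) = ∫ f d(p_x * p_y)`. -/
noncomputable def leftTranslate {K : Type*} [TopologicalSpace K] [T2Space K]
    [LocallyCompactSpace K] [MeasurableSpace K] [BorelSpace K]
    (S : SemitopologicalSemihypergroup K) (x : K) (f : K → ℂ) : K → ℂ :=
  fun y => ∫ z, f z ∂(S.convMeasure x y)

/-- `AP(K)`: the bounded continuous functions `f` whose left orbit `{L_x f : x ∈ K}` is relatively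
compact in the space of bounded continuous functions on `K` with the supremum norm, that is,
contained in a compact set of bounded continuous functions. -/
noncomputable def AP {K : Type*} [TopologicalSpace K] [T2Space K]
    [LocallyCompactSpace K] [MeasurableSpace K] [BorelSpace K]
    (S : SemitopologicalSemihypergroup K) : Submodule ℂ (K →ᵇ ℂ) where
  carrier := {f | ∃ C : Set (K →ᵇ ℂ), IsCompact C ∧ ∀ x, ∃ g ∈ C, ⇑g = S.leftTranslate x f}
  zero_mem' := ⟨{0}, isCompact_singleton, fun x => ⟨0, rfl, by
    ext y; simp [leftTranslate]⟩⟩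
  add_mem' := by
    rintro f f' ⟨C, hC, h⟩ ⟨C', hC', h'⟩
    refine ⟨C + C', hC.add hC', fun x => ?_⟩
    obtain ⟨g, hg, hgx⟩ := h x
    obtain ⟨g', hg', hgx'⟩ := h' x
    refine ⟨g + g', Set.add_mem_add hg hg', ?_⟩
    ext y
    have h1 : Integrable f (S.convMeasure x y) := f.integrable _
    have h2 : Integrable f' (S.convMeasure x y) := f'.integrable _
    simp only [BoundedContinuousFunction.coe_add, Pi.add_apply, hgx, hgx', leftTranslate]
    exact (integral_add h1 h2).symm
  smul_mem' := by
    rintro c f ⟨C, hC, h⟩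
    refine ⟨c • C, hC.smul c, fun x => ?_⟩
    obtain ⟨g, hg, hgx⟩ := h x
    refine ⟨c • g, Set.smul_mem_smul_set hg, ?_⟩
    ext y
    simp only [BoundedContinuousFunction.coe_smul, hgx, leftTranslate]
    exact (integral_smul c _).symm

/-- The constant function `1` is almost periodic. -/
theorem one_mem_AP {K : Type*} [TopologicalSpace K] [T2Space K]
    [LocallyCompactSpace K] [MeasurableSpace K] [BorelSpace K]
    (S : SemitopologicalSemihypergroup K) : (1 : K →ᵇ ℂ) ∈ S.AP :=
  ⟨{1}, isCompact_singleton, fun x => ⟨1, rfl, by ext y; simp [leftTranslate]⟩⟩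

/-- `m` is a mean on `AP(K)`: a functional with `‖m‖ = 1 = m(1)`. -/
def IsMean {K : Type*} [TopologicalSpace K] [T2Space K]
    [LocallyCompactSpace K] [MeasurableSpace K] [BorelSpace K]
    (S : SemitopologicalSemihypergroup K) (m : StrongDual ℂ S.AP) : Prop :=
  ‖m‖ = 1 ∧ m ⟨1, S.one_mem_AP⟩ = 1

/-- `AP(K)` is left amenable: there is a mean `m` on `AP(K)` such that, for all `x ∈ K` and
`f ∈ AP(K)`, the translate `L_x f` lies in `AP(K)` and `m(L_x f) = m(f)`. -/
def IsLeftAmenableAP {K : Type*} [TopologicalSpace K] [T2Space K]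
    [LocallyCompactSpace K] [MeasurableSpace K] [BorelSpace K]
    (S : SemitopologicalSemihypergroup K) : Prop :=
  ∃ m : StrongDual ℂ S.AP, S.IsMean m ∧
    ∀ (x : K) (f : S.AP), ∃ g : S.AP,
      ⇑(g : K →ᵇ ℂ) = S.leftTranslate x (f : K →ᵇ ℂ) ∧ m g = m f

/-! ### Actions on a dual Banach space with the weak* topology -/

/-- `π` is an action of the semihypergroup on `(X*, weak*)`. The vector integral
`π(s, π(t, u)) = ∫ π(ζ, u) d(p_s * p_t)(ζ)` is the weak integral in the locally convex space
`(X*, weak*)`, whose continuous functionals are the evaluations at the points of `X`. -/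
structure IsDualAction {K : Type*} [TopologicalSpace K] [T2Space K]
    [LocallyCompactSpace K] [MeasurableSpace K] [BorelSpace K]
    (S : SemitopologicalSemihypergroup K) {X : Type*} [NormedAddCommGroup X] [NormedSpace ℂ X]
    (π : K → WeakDual ℂ X → WeakDual ℂ X) : Prop where
  comp : ∀ (s t : K) (u : WeakDual ℂ X) (φ : X),
    Integrable (fun ζ => π ζ u φ) (S.convMeasure s t) ∧
      π s (π t u) φ = ∫ ζ, π ζ u φ ∂(S.convMeasure s t)
  identity : ∀ e : K, S.IsTwoSidedIdentity e → ∀ u : WeakDual ℂ X, π e u = u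

end SemitopologicalSemihypergroup

/-- Separate continuity of `π : K × X* → X*` for the weak* topology on `X*`. -/
def IsSeparatelyContinuousAction {K : Type*} [TopologicalSpace K] {X : Type*}
    [NormedAddCommGroup X] [NormedSpace ℂ X] (π : K → WeakDual ℂ X → WeakDual ℂ X) : Prop :=
  (∀ s : K, Continuous (π s)) ∧ ∀ u : WeakDual ℂ X, Continuous fun s : K => π s u

/-- Each `π_s` is affine, i.e. preserves convex combinations. -/
def IsAffineAction {K : Type*} {X : Type*} [NormedAddCommGroup X] [NormedSpace ℂ X]
    (π : K → WeakDual ℂ X → WeakDual ℂ X) : Prop :=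
  ∀ (s : K) (u v : WeakDual ℂ X) (a b : ℝ), 0 ≤ a → 0 ≤ b → a + b = 1 →
    π s ((a : ℂ) • u + (b : ℂ) • v) = (a : ℂ) • π s u + (b : ℂ) • π s v

/-- Equicontinuity of `{π_s : s ∈ K}` on compact sets: for every weak* compact `C ⊆ X*`, every
`x ∈ C` and every weak* neighbourhood `U` of `0` there is a weak* neighbourhood `V` of `0` such that
`π(s, y) - π(s, x) ∈ U` for all `s ∈ K` whenever `y ∈ C` and `y - x ∈ V`. -/
def IsEquicontinuousAction {K : Type*} {X : Type*} [NormedAddCommGroup X] [NormedSpace ℂ X]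
    (π : K → WeakDual ℂ X → WeakDual ℂ X) : Prop :=
  ∀ C : Set (WeakDual ℂ X), IsCompact C → ∀ x ∈ C, ∀ U ∈ 𝓝 (0 : WeakDual ℂ X),
    ∃ V ∈ 𝓝 (0 : WeakDual ℂ X), ∀ y ∈ C, y - x ∈ V → ∀ s : K, π s y - π s x ∈ U

/-!
An invariant mean `m` on `AP(K)`, applied to the coefficients `s ↦ π(s, ω₀)(φ)` of a bounded orbit
(which are almost periodic by equicontinuity and Arzelà–Ascoli), defines a point `x₀` of the dual
space. Up to a constant, a weak* continuous affine function is the real part of an evaluation, hence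
it commutes with taking the mean over the orbit; applied to `u ↦ π(a, u)(φ)` and combined with the
invariance of `m`, this shows that `x₀` is fixed.

Conversely, the adjoints of the translations of `AP(K)` preserve the hyperplane of functionals `u`
with `u(1) = 1`. Extending this action affinely to the whole dual space yields an invariant
functional with `m(1) = 1`, possibly of norm larger than `1`. The averages of the translations form
a compact convex semigroup, and an extreme point of a minimal left ideal is an average `P` with
`P ∘ L_x ∘ P = P` for all `x`. Then `φ(f) = (P f)(y)` is normalized and of norm at most `1`, and `m`
shows that it is invariant: the coefficient map `c(f) = (x ↦ φ(L_x f))` commutes with translations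
and `c(P f)` is the constant `φ(f)`, so `φ(f) = m(c(P f)) = m(c(f))`.
-/

/-! ### Integration on the cone of positive regular measures -/

namespace PositiveRegularMeasure

variable {K : Type*} [TopologicalSpace K] [T2Space K] [MeasurableSpace K] [BorelSpace K]

instance (μ : PositiveRegularMeasure K) : IsFiniteMeasure μ.toMeasure :=
  SHG.isFiniteMeasure_variation _

instance (μ : PositiveRegularMeasure K) : μ.toMeasure.Regular := μ.val.2

noncomputable instance : Add (PositiveRegularMeasure K) where
  add μ ν := ⟨μ.val + ν.val, fun A hA =>
    ⟨add_nonneg (μ.nonneg A hA).1 (ν.nonneg A hA).1,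
      by simp [(μ.nonneg A hA).2, (ν.nonneg A hA).2]⟩⟩

noncomputable instance : SMul ℝ≥0 (PositiveRegularMeasure K) where
  smul c μ := ⟨((c : ℝ) : ℂ) • μ.val, fun A hA => by
    simpa [(μ.nonneg A hA).2] using mul_nonneg c.2 (μ.nonneg A hA).1⟩

/-- The point mass `p_x` as an element of `M⁺(K)`. -/
noncomputable def dirac (x : K) : PositiveRegularMeasure K :=
  ⟨pointMass x, isNonnegMeasure_pointMass x⟩

@[ext]
theorem ext {μ ν : PositiveRegularMeasure K} (h : μ.val = ν.val) : μ = ν := by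
  cases μ
  cases ν
  congr

theorem val_smul (c : ℝ≥0) (μ : PositiveRegularMeasure K) :
    (c • μ).val = ((c : ℝ) : ℂ) • μ.val := rfl

theorem toMeasure_apply (μ : PositiveRegularMeasure K) {A : Set K} (hA : MeasurableSet A) :
    μ.toMeasure A = ENNReal.ofReal ((μ.val : ComplexMeasure K) A).re :=
  μ.nonneg.variation_apply hA

theorem toMeasure_add (μ ν : PositiveRegularMeasure K) :
    (μ + ν).toMeasure = μ.toMeasure + ν.toMeasure := by
  ext A hA
  rw [Measure.add_apply, toMeasure_apply _ hA, toMeasure_apply _ hA, toMeasure_apply _ hA,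
    ← ENNReal.ofReal_add (μ.nonneg A hA).1 (ν.nonneg A hA).1]
  rfl

theorem toMeasure_smul (c : ℝ≥0) (μ : PositiveRegularMeasure K) :
    (c • μ).toMeasure = c • μ.toMeasure := by
  ext A hA
  rw [Measure.smul_apply, toMeasure_apply _ hA, toMeasure_apply _ hA, ENNReal.smul_def,
    smul_eq_mul, ← ENNReal.ofReal_coe_nnreal, ← ENNReal.ofReal_mul c.coe_nonneg]
  simp [val_smul]

theorem toMeasure_dirac (x : K) : (dirac x).toMeasure = Measure.dirac x := by
  ext A hA
  rw [toMeasure_apply _ hA, Measure.dirac_apply' _ hA]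
  by_cases hx : x ∈ A
  · have h : (pointMass x : ComplexMeasure K) A = 1 := VectorMeasure.dirac_apply_of_mem hA hx
    simp [dirac, h, hx]
  · have h : (pointMass x : ComplexMeasure K) A = 0 := VectorMeasure.dirac_apply_of_notMem hx
    simp [dirac, h, hx]

theorem integral_smul_add_smul {E : Type*} [NormedAddCommGroup E] [NormedSpace ℝ E]
    {μ ν : PositiveRegularMeasure K} {f : K → E} (hμ : Integrable f μ.toMeasure)
    (hν : Integrable f ν.toMeasure) (a b : ℝ≥0) :
    ∫ x, f x ∂(a • μ + b • ν).toMeasure =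
      a • ∫ x, f x ∂μ.toMeasure + b • ∫ x, f x ∂ν.toMeasure := by
  simp_rw [toMeasure_add, toMeasure_smul]
  rw [integral_add_measure hμ.smul_measure_nnreal hν.smul_measure_nnreal,
    integral_smul_nnreal_measure, integral_smul_nnreal_measure]

theorem continuous_iff {Y : Type*} [TopologicalSpace Y] {Θ : Y → PositiveRegularMeasure K} :
    Continuous Θ ↔
      (∀ f : CompactlySupportedContinuousMap K ℝ≥0,
        Continuous fun y => ∫ x, (f x : ℝ) ∂(Θ y).toMeasure) ∧
      Continuous fun y => (Θ y).toMeasure.real Set.univ := by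
  rw [continuous_induced_rng, continuous_prodMk, continuous_pi_iff]
  rfl

theorem continuous_integral_compactlySupported (f : CompactlySupportedContinuousMap K ℝ≥0) :
    Continuous fun μ : PositiveRegularMeasure K => ∫ x, (f x : ℝ) ∂μ.toMeasure :=
  (continuous_iff.mp continuous_id).1 f

theorem continuous_mass :
    Continuous fun μ : PositiveRegularMeasure K => μ.toMeasure.real Set.univ :=
  (continuous_iff.mp continuous_id).2

theorem continuous_dirac : Continuous (dirac : K → PositiveRegularMeasure K) := by
  refine continuous_iff.mpr ⟨fun f => ?_, ?_⟩
  · simp only [toMeasure_dirac, integral_dirac]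
    fun_prop
  · simp only [toMeasure_dirac, probReal_univ]
    fun_prop

theorem integrable_compactlySupported (f : CompactlySupportedContinuousMap K ℝ≥0)
    (μ : PositiveRegularMeasure K) : Integrable (fun x => (f x : ℝ)) μ.toMeasure :=
  (NNReal.continuous_coe.comp f.continuous).integrable_of_hasCompactSupport
    (f.hasCompactSupport.comp_left rfl)

section LocallyCompact

variable [LocallyCompactSpace K]

theorem exists_compactlySupported_le_lt_integral {f : K →ᵇ ℝ} (hf : 0 ≤ f)
    {μ : PositiveRegularMeasure K} {a : ℝ} (ha : a < ∫ x, f x ∂μ.toMeasure) :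
    ∃ g : CompactlySupportedContinuousMap K ℝ≥0,
      (∀ x, (g x : ℝ) ≤ f x) ∧ a < ∫ x, (g x : ℝ) ∂μ.toMeasure := by
  set η := (∫ x, f x ∂μ.toMeasure - a) / (‖f‖ + 1)
  have hη : 0 < η := div_pos (sub_pos.mpr ha) (by positivity)
  obtain ⟨F, -, hF, hFη⟩ := MeasurableSet.univ.exists_isCompact_sdiff_lt
    (measure_ne_top μ.toMeasure _) (ENNReal.ofReal_pos.mpr hη).ne'
  obtain ⟨χ, hχF, hχ, -, hχ01⟩ := exists_continuousMap_one_of_isCompact_subset_isOpen hF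
    isOpen_univ (Set.subset_univ F)
  let g : CompactlySupportedContinuousMap K ℝ≥0 :=
    ⟨⟨fun x => (f x * χ x).toNNReal, by fun_prop⟩,
      (HasCompactSupport.mul_left (f := f) hχ).comp_left Real.toNNReal_zero⟩
  have hg (x : K) : (g x : ℝ) = f x * χ x := Real.coe_toNNReal _ (mul_nonneg (hf x) (hχ01 x).1)
  have hcompl : ∫ x in Fᶜ, f x ∂μ.toMeasure ≤ ‖f‖ * η := by
    rw [← Set.compl_eq_univ_sdiff] at hFη
    calc ∫ x in Fᶜ, f x ∂μ.toMeasure ≤ ‖f‖ * μ.toMeasure.real Fᶜ :=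
          (le_abs_self _).trans (norm_setIntegral_le_of_norm_le_const (measure_lt_top _ _)
            fun x _ => f.norm_coe_le_norm x)
      _ ≤ ‖f‖ * η := by
          gcongr
          exact ENNReal.toReal_le_of_le_ofReal hη.le hFη.le
  have hmain : ∫ x in F, f x ∂μ.toMeasure ≤ ∫ x, (g x : ℝ) ∂μ.toMeasure :=
    calc ∫ x in F, f x ∂μ.toMeasure = ∫ x in F, (g x : ℝ) ∂μ.toMeasure :=
          setIntegral_congr_fun hF.measurableSet fun x hx => by simp [hg, hχF hx]
      _ ≤ _ := setIntegral_le_integral (integrable_compactlySupported g μ)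
          (.of_forall fun x => (g x).2)
  refine ⟨g, fun x => (hg x).trans_le (mul_le_of_le_one_right (hf x) (hχ01 x).2), ?_⟩
  have hsplit := integral_add_compl hF.measurableSet (f.integrable μ.toMeasure)
  have hηeq : ‖f‖ * η + η = ∫ x, f x ∂μ.toMeasure - a := by
    rw [← add_one_mul, mul_div_cancel₀ _ (by positivity)]
  linarith

theorem lowerSemicontinuous_integral_of_nonneg {f : K →ᵇ ℝ} (hf : 0 ≤ f) :
    LowerSemicontinuous fun μ : PositiveRegularMeasure K => ∫ x, f x ∂μ.toMeasure := by
  intro μ a ha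
  obtain ⟨g, hgf, hg⟩ := exists_compactlySupported_le_lt_integral hf ha
  filter_upwards [(continuous_integral_compactlySupported g).continuousAt.eventually_const_lt hg]
    with ν hν
  exact hν.trans_le (integral_mono (integrable_compactlySupported g ν) (f.integrable _) hgf)

theorem lowerSemicontinuous_integral (f : K →ᵇ ℝ) :
    LowerSemicontinuous fun μ : PositiveRegularMeasure K => ∫ x, f x ∂μ.toMeasure := by
  have hf : 0 ≤ f + BoundedContinuousFunction.const K ‖f‖ := fun x =>
    neg_le_iff_add_nonneg.mp (neg_le_of_abs_le (f.norm_coe_le_norm x))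
  have hshift (μ : PositiveRegularMeasure K) : ∫ x, f x ∂μ.toMeasure =
      ∫ x, (f + BoundedContinuousFunction.const K ‖f‖) x ∂μ.toMeasure +
        -‖f‖ * μ.toMeasure.real Set.univ := by
    change _ = ∫ x, (f x + ‖f‖) ∂μ.toMeasure + _
    rw [integral_add (f.integrable _) (integrable_const _), integral_const, smul_eq_mul]
    ring
  simp_rw [hshift]
  exact (lowerSemicontinuous_integral_of_nonneg hf).add
    (continuous_mass.const_mul (-‖f‖)).lowerSemicontinuous

theorem continuous_integral_real (f : K →ᵇ ℝ) :
    Continuous fun μ : PositiveRegularMeasure K => ∫ x, f x ∂μ.toMeasure := by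
  refine continuous_iff_lower_upperSemicontinuous.mpr ⟨lowerSemicontinuous_integral f, ?_⟩
  intro μ a ha
  have h := lowerSemicontinuous_integral (-f) μ (-a)
  simp only [BoundedContinuousFunction.coe_neg, Pi.neg_apply, integral_neg, neg_lt_neg_iff] at h
  exact h ha

theorem continuous_integral (f : K →ᵇ ℂ) :
    Continuous fun μ : PositiveRegularMeasure K => ∫ x, f x ∂μ.toMeasure := by
  have hre := continuous_integral_real (Complex.reCLM.compLeftContinuousBounded K f)
  have him := continuous_integral_real (Complex.imCLM.compLeftContinuousBounded K f)
  convert (Complex.continuous_ofReal.comp hre).add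
    ((Complex.continuous_ofReal.comp him).mul continuous_const) with μ
  exact (integral_re_add_im (𝕜 := ℂ) (f.integrable _)).symm

end LocallyCompact

theorem integral_compactlySupported_mem_closure {D : Set (PositiveRegularMeasure K)}
    (hdirac : ∀ x, dirac x ∈ D)
    (hconv : ∀ μ ∈ D, ∀ ν ∈ D, ∀ a b : ℝ≥0, a + b = 1 → a • μ + b • ν ∈ D)
    {ι : Type*} [Finite ι] (g : ι → CompactlySupportedContinuousMap K ℝ≥0)
    (μ : PositiveRegularMeasure K) [IsProbabilityMeasure μ.toMeasure] :
    (fun i => ∫ x, (g i x : ℝ) ∂μ.toMeasure) ∈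
      closure ((fun ν i => ∫ x, (g i x : ℝ) ∂ν.toMeasure : _ → ι → ℝ) '' D) := by
  have := Fintype.ofFinite ι
  have hconvex :
      Convex ℝ ((fun ν i => ∫ x, (g i x : ℝ) ∂ν.toMeasure : _ → ι → ℝ) '' D) := by
    rintro _ ⟨μ, hμ, rfl⟩ _ ⟨ν, hν, rfl⟩ a b ha hb hab
    lift a to ℝ≥0 using ha
    lift b to ℝ≥0 using hb
    refine ⟨_, hconv μ hμ ν hν a b (NNReal.eq hab), funext fun i => ?_⟩
    exact integral_smul_add_smul (integrable_compactlySupported _ _)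
      (integrable_compactlySupported _ _) a b
  have hgμ : Integrable (fun x i => (g i x : ℝ)) μ.toMeasure :=
    .of_eval fun i => integrable_compactlySupported (g i) μ
  have heq : ∫ x, (fun i => (g i x : ℝ)) ∂μ.toMeasure =
      fun i => ∫ x, (g i x : ℝ) ∂μ.toMeasure :=
    funext fun i => eval_integral (fun i => integrable_compactlySupported (g i) μ) i
  rw [← heq]
  refine hconvex.closure.integral_mem isClosed_closure (.of_forall fun x => ?_) hgμ
  exact subset_closure ⟨dirac x, hdirac x, by simp [toMeasure_dirac]⟩

theorem mem_closure_of_dirac_mem_of_convex {D : Set (PositiveRegularMeasure K)}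
    (hdirac : ∀ x, dirac x ∈ D)
    (hconv : ∀ μ ∈ D, ∀ ν ∈ D, ∀ a b : ℝ≥0, a + b = 1 → a • μ + b • ν ∈ D)
    (hmass : ∀ ν ∈ D, ν.toMeasure.real Set.univ = 1)
    (μ : PositiveRegularMeasure K) [IsProbabilityMeasure μ.toMeasure] : μ ∈ closure D := by
  rw [mem_closure_iff_nhds]
  intro U hU
  rw [nhds_induced, nhds_prod_eq, nhds_pi] at hU
  obtain ⟨W, hW, hWU⟩ := Filter.mem_comap.mp hU
  obtain ⟨V, hV, V', hV', hVW⟩ := Filter.mem_prod_iff.mp hW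
  obtain ⟨I, hI, t, ht, hIt⟩ := Filter.mem_pi.mp hV
  have := hI.to_subtype
  obtain ⟨_, hνt, ν, hν, rfl⟩ := mem_closure_iff_nhds.mp
    (integral_compactlySupported_mem_closure hdirac hconv (fun i : I => i.1) μ)
    (Set.pi Set.univ fun i : I => t i) (set_pi_mem_nhds Set.finite_univ fun i _ => ht i)
  refine ⟨ν, hWU (hVW ⟨hIt fun i hi => hνt ⟨i, hi⟩ trivial, ?_⟩), hν⟩
  have hμ := mem_of_mem_nhds hV'
  simpa only [hmass ν hν, probReal_univ] using hμ

theorem integral_map_eq_integral_integral_dirac [LocallyCompactSpace K]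
    {Θ : PositiveRegularMeasure K → PositiveRegularMeasure K}
    (hΘ : Continuous Θ) (hadd : ∀ μ ν, Θ (μ + ν) = Θ μ + Θ ν)
    (hsmul : ∀ (c : ℝ≥0) μ, Θ (c • μ) = c • Θ μ)
    (hmass : ∀ x, (Θ (dirac x)).toMeasure.real Set.univ = 1) (f : K →ᵇ ℂ)
    (μ : PositiveRegularMeasure K) [IsProbabilityMeasure μ.toMeasure] :
    ∫ z, f z ∂(Θ μ).toMeasure = ∫ x, ∫ z, f z ∂(Θ (dirac x)).toMeasure ∂μ.toMeasure := by
  let F : K →ᵇ ℂ := .ofNormedAddCommGroup (fun x => ∫ z, f z ∂(Θ (dirac x)).toMeasure)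
    ((continuous_integral f).comp (hΘ.comp continuous_dirac)) ‖f‖ fun x => by
      simpa [hmass] using norm_integral_le_of_norm_le_const (μ := (Θ (dirac x)).toMeasure)
        (.of_forall f.norm_coe_le_norm)
  let D : Set (PositiveRegularMeasure K) :=
    {ν | ν.toMeasure.real Set.univ = 1 ∧ ∫ z, f z ∂(Θ ν).toMeasure = ∫ x, F x ∂ν.toMeasure}
  have hdirac (x : K) : dirac x ∈ D :=
    ⟨by simp [toMeasure_dirac], by rw [toMeasure_dirac, integral_dirac]; rfl⟩
  have hconv : ∀ μ ∈ D, ∀ ν ∈ D, ∀ a b : ℝ≥0, a + b = 1 → a • μ + b • ν ∈ D := by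
    rintro μ ⟨hμ1, hμ⟩ ν ⟨hν1, hν⟩ a b hab
    refine ⟨?_, ?_⟩
    · rw [toMeasure_add, toMeasure_smul, toMeasure_smul, measureReal_add_apply,
        measureReal_nnreal_smul_apply, measureReal_nnreal_smul_apply, hμ1, hν1, mul_one, mul_one]
      exact_mod_cast hab
    · rw [hadd, hsmul, hsmul, integral_smul_add_smul (f.integrable _) (f.integrable _),
        integral_smul_add_smul (F.integrable _) (F.integrable _), hμ, hν]
  have hD : IsClosed {ν : PositiveRegularMeasure K |
      ∫ z, f z ∂(Θ ν).toMeasure = ∫ x, F x ∂ν.toMeasure} :=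
    isClosed_eq ((continuous_integral f).comp hΘ) (continuous_integral F)
  exact closure_minimal (fun ν hν => hν.2) hD
    (mem_closure_of_dirac_mem_of_convex hdirac hconv (fun ν hν => hν.1) μ)

end PositiveRegularMeasure

/-! ### Translations of almost periodic functions -/

theorem continuous_of_continuous_apply_of_isCompact {Y Z : Type*}
    [TopologicalSpace Y] [TopologicalSpace Z] {C : Set (Z →ᵇ ℂ)} (hC : IsCompact C)
    {F : Y → Z →ᵇ ℂ} (hFC : ∀ y, F y ∈ C) (hF : ∀ z, Continuous fun y => F y z) :
    Continuous F := by
  have : CompactSpace C := isCompact_iff_compactSpace.mp hC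
  have hcoe : Continuous fun g : C => ⇑(g : Z →ᵇ ℂ) :=
    BoundedContinuousFunction.continuous_coe.comp continuous_subtype_val
  have hinj : Function.Injective fun g : C => ⇑(g : Z →ᵇ ℂ) :=
    DFunLike.coe_injective.comp Subtype.val_injective
  have hcod : Continuous (Set.codRestrict F C hFC) :=
    (hcoe.isClosedEmbedding hinj).isEmbedding.continuous_iff.mpr (continuous_pi hF)
  exact continuous_subtype_val.comp hcod

theorem integrable_of_continuous_of_totallyBounded_range {Y E : Type*} [TopologicalSpace Y]
    [MeasurableSpace Y] [OpensMeasurableSpace Y] [NormedAddCommGroup E]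
    {F : Y → E} (hF : Continuous F) (hb : TotallyBounded (Set.range F)) (ν : Measure Y)
    [IsFiniteMeasure ν] : Integrable F ν := by
  borelize E
  obtain ⟨R, hR⟩ := hb.isBounded.exists_norm_le
  exact .of_bound (stronglyMeasurable_iff_measurable_separable.mpr
    ⟨hF.measurable, hb.isSeparable⟩).aestronglyMeasurable R (.of_forall fun y => hR _ ⟨y, rfl⟩)

namespace SemitopologicalSemihypergroup

open PositiveRegularMeasure

variable {K : Type*} [TopologicalSpace K] [T2Space K] [LocallyCompactSpace K]
    [MeasurableSpace K] [BorelSpace K] (S : SemitopologicalSemihypergroup K)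

/-- The product `*` restricted to `M⁺(K)`. -/
noncomputable def posConv (μ ν : PositiveRegularMeasure K) : PositiveRegularMeasure K :=
  ⟨S.conv μ.val ν.val, S.conv_nonneg μ ν⟩

instance (x y : K) : IsProbabilityMeasure (S.posConv (dirac x) (dirac y)).toMeasure :=
  inferInstanceAs (IsProbabilityMeasure (S.convMeasure x y))

theorem posConv_add (ω μ ν : PositiveRegularMeasure K) :
    S.posConv ω (μ + ν) = S.posConv ω μ + S.posConv ω ν :=
  PositiveRegularMeasure.ext (map_add _ _ _)

theorem add_posConv (μ ν ω : PositiveRegularMeasure K) :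
    S.posConv (μ + ν) ω = S.posConv μ ω + S.posConv ν ω :=
  PositiveRegularMeasure.ext (S.conv.map_add₂ _ _ _)

theorem posConv_smul (ω : PositiveRegularMeasure K) (c : ℝ≥0) (μ : PositiveRegularMeasure K) :
    S.posConv ω (c • μ) = c • S.posConv ω μ :=
  PositiveRegularMeasure.ext (map_smul _ _ _)

theorem smul_posConv (c : ℝ≥0) (μ ω : PositiveRegularMeasure K) :
    S.posConv (c • μ) ω = c • S.posConv μ ω :=
  PositiveRegularMeasure.ext (S.conv.map_smul₂ _ _ _)

theorem posConv_assoc (μ ν ω : PositiveRegularMeasure K) :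
    S.posConv (S.posConv μ ν) ω = S.posConv μ (S.posConv ν ω) :=
  PositiveRegularMeasure.ext (S.conv_assoc _ _ _)

theorem integral_posConv_dirac_left (x : K) (f : K →ᵇ ℂ) (μ : PositiveRegularMeasure K)
    [IsProbabilityMeasure μ.toMeasure] :
    ∫ z, f z ∂(S.posConv (dirac x) μ).toMeasure =
      ∫ y, ∫ z, f z ∂S.convMeasure x y ∂μ.toMeasure :=
  integral_map_eq_integral_integral_dirac (S.continuous_conv_left (dirac x))
    (S.posConv_add _) (S.posConv_smul _)
    (fun y => probReal_univ (μ := S.convMeasure x y)) f μ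

theorem integral_posConv_dirac_right (y : K) (f : K →ᵇ ℂ) (μ : PositiveRegularMeasure K)
    [IsProbabilityMeasure μ.toMeasure] :
    ∫ z, f z ∂(S.posConv μ (dirac y)).toMeasure =
      ∫ x, ∫ z, f z ∂S.convMeasure x y ∂μ.toMeasure :=
  integral_map_eq_integral_integral_dirac (S.continuous_conv_right (dirac y))
    (fun _ _ => S.add_posConv _ _ _) (fun _ _ => S.smul_posConv _ _ _)
    (fun x => probReal_univ (μ := S.convMeasure x y)) f μ

theorem integral_integral_convMeasure (s t y : K) (f : K →ᵇ ℂ) :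
    ∫ z, ∫ w, f w ∂S.convMeasure s z ∂S.convMeasure t y =
      ∫ ζ, ∫ w, f w ∂S.convMeasure ζ y ∂S.convMeasure s t := by
  have hleft := S.integral_posConv_dirac_left s f (S.posConv (dirac t) (dirac y))
  have hright := S.integral_posConv_dirac_right y f (S.posConv (dirac s) (dirac t))
  rw [S.posConv_assoc] at hright
  exact hleft.symm.trans hright

theorem norm_leftTranslate_le (x : K) (f : K →ᵇ ℂ) (y : K) : ‖S.leftTranslate x f y‖ ≤ ‖f‖ := by
  simpa [leftTranslate] using norm_integral_le_of_norm_le_const (μ := S.convMeasure x y)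
    (.of_forall f.norm_coe_le_norm)

theorem continuous_leftTranslate (x : K) (f : K →ᵇ ℂ) : Continuous (S.leftTranslate x f) :=
  (continuous_integral f).comp ((S.continuous_conv_left (dirac x)).comp continuous_dirac)

/-- The left translation `L_x` as an operator on the bounded continuous functions. -/
noncomputable def translate (x : K) : (K →ᵇ ℂ) →L[ℂ] (K →ᵇ ℂ) :=
  LinearMap.mkContinuous
    { toFun f := .ofNormedAddCommGroup (S.leftTranslate x f) (S.continuous_leftTranslate x f) ‖f‖
        (S.norm_leftTranslate_le x f)
      map_add' f g := by
        ext y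
        exact integral_add (f.integrable _) (g.integrable _)
      map_smul' c f := by
        ext y
        exact integral_smul c _ }
    1 fun f => by
      rw [one_mul]
      exact BoundedContinuousFunction.norm_ofNormedAddCommGroup_le _ (norm_nonneg f)
        (S.norm_leftTranslate_le x f)

theorem coe_translate (x : K) (f : K →ᵇ ℂ) : ⇑(S.translate x f) = S.leftTranslate x f := rfl

theorem translate_apply (x : K) (f : K →ᵇ ℂ) (y : K) :
    S.translate x f y = ∫ z, f z ∂S.convMeasure x y := rfl

theorem norm_translate_apply_le (x : K) (f : K →ᵇ ℂ) : ‖S.translate x f‖ ≤ ‖f‖ := by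
  simpa using (S.translate x).le_of_opNorm_le (LinearMap.mkContinuous_norm_le _ zero_le_one _) f

theorem translate_one (x : K) : S.translate x 1 = 1 := by
  ext y
  simp [translate_apply]

theorem translate_of_isTwoSidedIdentity {e : K} (he : S.IsTwoSidedIdentity e) (f : K →ᵇ ℂ) :
    S.translate e f = f := by
  ext y
  have h : S.convMeasure e y = Measure.dirac y := by
    rw [← toMeasure_dirac]
    simp only [convMeasure, dirac, (he y).2]
  rw [translate_apply, h, integral_dirac]

theorem continuous_translate_apply (f : K →ᵇ ℂ) (y : K) :
    Continuous fun x => S.translate x f y :=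
  (continuous_integral f).comp ((S.continuous_conv_right (dirac y)).comp continuous_dirac)

theorem mem_AP_iff {f : K →ᵇ ℂ} :
    f ∈ S.AP ↔ TotallyBounded (Set.range fun x => S.translate x f) := by
  constructor
  · rintro ⟨C, hC, h⟩
    refine hC.totallyBounded.subset (Set.range_subset_iff.mpr fun x => ?_)
    obtain ⟨g, hg, hgx⟩ := h x
    rwa [← DFunLike.coe_injective (hgx.trans (S.coe_translate x f).symm)]
  · intro h
    exact ⟨_, h.closure.isCompact_of_isClosed isClosed_closure,
      fun x => ⟨S.translate x f, subset_closure ⟨x, rfl⟩, rfl⟩⟩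

theorem isClosed_AP : IsClosed (S.AP : Set (K →ᵇ ℂ)) := by
  refine isClosed_of_closure_subset fun f hf => ?_
  rw [SetLike.mem_coe, mem_AP_iff, Metric.totallyBounded_iff]
  intro ε hε
  obtain ⟨g, hg, hfg⟩ := Metric.mem_closure_iff.mp hf (ε / 2) (half_pos hε)
  obtain ⟨t, ht, hgt⟩ := Metric.totallyBounded_iff.mp (S.mem_AP_iff.mp hg) (ε / 2) (half_pos hε)
  refine ⟨t, ht, Set.range_subset_iff.mpr fun x => ?_⟩
  obtain ⟨h, hh, hgh⟩ := Set.mem_iUnion₂.mp (hgt ⟨x, rfl⟩)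
  have hfgx : dist (S.translate x f) (S.translate x g) ≤ dist f g := by
    simpa only [dist_eq_norm, map_sub] using S.norm_translate_apply_le x (f - g)
  refine Set.mem_iUnion₂.mpr ⟨h, hh, (dist_triangle _ (S.translate x g) _).trans_lt ?_⟩
  exact (add_lt_add (hfgx.trans_lt hfg) hgh).trans_eq (add_halves ε)

instance : CompleteSpace S.AP := S.isClosed_AP.completeSpace_coe

variable {S}

theorem continuous_translate {f : K →ᵇ ℂ} (hf : f ∈ S.AP) :
    Continuous fun x => S.translate x f :=
  continuous_of_continuous_apply_of_isCompact
    ((S.mem_AP_iff.mp hf).closure.isCompact_of_isClosed isClosed_closure)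
    (fun x => subset_closure ⟨x, rfl⟩) (S.continuous_translate_apply f)

theorem integrable_translate {f : K →ᵇ ℂ} (hf : f ∈ S.AP) (ν : Measure K) [IsFiniteMeasure ν] :
    Integrable (fun x => S.translate x f) ν :=
  integrable_of_continuous_of_totallyBounded_range (continuous_translate hf)
    (S.mem_AP_iff.mp hf) ν

theorem translate_translate {f : K →ᵇ ℂ} (hf : f ∈ S.AP) (s t : K) :
    S.translate t (S.translate s f) = ∫ ζ, S.translate ζ f ∂S.convMeasure s t := by
  ext y
  exact (S.integral_integral_convMeasure s t y f).trans
    ((BoundedContinuousFunction.evalCLM ℂ y).integral_comp_comm (integrable_translate hf _))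

theorem translate_mem_AP {f : K →ᵇ ℂ} (hf : f ∈ S.AP) (s : K) : S.translate s f ∈ S.AP := by
  refine S.mem_AP_iff.mpr ((S.mem_AP_iff.mp hf).convexHull.closure.subset ?_)
  rw [Set.range_subset_iff]
  intro t
  rw [translate_translate hf]
  exact (convex_convexHull ℝ _).closure.integral_mem isClosed_closure
    (.of_forall fun x => subset_closure (subset_convexHull ℝ _ ⟨x, rfl⟩))
    (integrable_translate hf _)

variable (S) in
/-- The left translation `L_x` as an operator on `AP(K)`. -/
noncomputable def translateAP (x : K) : S.AP →L[ℂ] S.AP :=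
  (S.translate x ∘L S.AP.subtypeL).codRestrict S.AP fun f => translate_mem_AP f.2 x

theorem continuous_translateAP (f : S.AP) : Continuous fun x => S.translateAP x f :=
  (continuous_translate f.2).subtype_mk _

theorem totallyBounded_orbit_translateAP (f : S.AP) :
    TotallyBounded (Set.range fun x => S.translateAP x f) := by
  refine (totallyBounded_preimage isUniformEmbedding_subtype_val.isUniformInducing
    (S.mem_AP_iff.mp f.2)).subset ?_
  rintro _ ⟨x, rfl⟩
  exact ⟨x, rfl⟩

/-- `T` is an antirepresentation of `K` by contractions of a normed space, i.e.
`T_t T_s = ∫ T_ζ d(p_s * p_t)(ζ)`, with continuous and relatively compact orbits. The translations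
of `AP(K)` are the example to keep in mind; the adjoints of `T` act on the dual space. -/
structure IsAlmostPeriodicRep (S : SemitopologicalSemihypergroup K) {X : Type*}
    [NormedAddCommGroup X] [NormedSpace ℂ X] (T : K → X →L[ℂ] X) : Prop where
  norm_apply_le : ∀ s f, ‖T s f‖ ≤ ‖f‖
  totallyBounded_orbit : ∀ f, TotallyBounded (Set.range fun s => T s f)
  continuous_orbit : ∀ f, Continuous fun s => T s f
  comp : ∀ s t f, T t (T s f) = ∫ ζ, T ζ f ∂S.convMeasure s t
  apply_of_isTwoSidedIdentity : ∀ e, S.IsTwoSidedIdentity e → ∀ f, T e f = f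

theorem isAlmostPeriodicRep_translateAP : S.IsAlmostPeriodicRep S.translateAP where
  norm_apply_le s f := S.norm_translate_apply_le s f
  totallyBounded_orbit f := totallyBounded_orbit_translateAP f
  continuous_orbit f := continuous_translateAP f
  comp s t f := Subtype.ext <| (translate_translate f.2 s t).trans <|
    S.AP.subtypeL.integral_comp_comm <| integrable_of_continuous_of_totallyBounded_range
      (continuous_translateAP f) (totallyBounded_orbit_translateAP f) _
  apply_of_isTwoSidedIdentity _ he f := Subtype.ext (S.translate_of_isTwoSidedIdentity he f)

end SemitopologicalSemihypergroup

/-! ### Averages of almost periodic representations -/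

theorem exists_minimal_isClosed_mapsTo {Y : Type*} [TopologicalSpace Y] [T2Space Y]
    {C : Set Y} (hC : IsCompact C) (hne : C.Nonempty) (F : Set (Y → Y))
    (hF : ∀ L ∈ F, Set.MapsTo L C C) :
    ∃ D ⊆ C, Minimal (fun D => IsClosed D ∧ D.Nonempty ∧ ∀ L ∈ F, Set.MapsTo L D D) D := by
  obtain ⟨D, hDC, hD⟩ := zorn_superset_nonempty
    {D | D ⊆ C ∧ IsClosed D ∧ D.Nonempty ∧ ∀ L ∈ F, Set.MapsTo L D D} (by
      intro c hc hchain hcne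
      have := hcne.to_subtype
      have hdir : DirectedOn (· ⊇ ·) c := fun D hD D' hD' =>
        (hchain.total hD hD').elim (fun h => ⟨D, hD, subset_rfl, h⟩)
          fun h => ⟨D', hD', h, subset_rfl⟩
      refine ⟨⋂₀ c, ⟨?_, isClosed_sInter fun D hD => (hc hD).2.1, ?_, ?_⟩,
        fun D hD => Set.sInter_subset_of_mem hD⟩
      · obtain ⟨D, hD⟩ := hcne
        exact (Set.sInter_subset_of_mem hD).trans (hc hD).1
      · exact IsCompact.nonempty_sInter_of_directed_nonempty_isCompact_isClosed hdir
          (fun D hD => (hc hD).2.2.1)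
          (fun D hD => hC.of_isClosed_subset (hc hD).2.1 (hc hD).1) fun D hD => (hc hD).2.1
      · exact fun L hL x hx D hD => (hc hD).2.2.2 L hL (hx D hD))
    C ⟨subset_rfl, hC.isClosed, hne, hF⟩
  exact ⟨D, hDC, hD.prop.2, fun D' hD' hle => hD.le_of_le ⟨hle.trans hDC, hD'⟩ hle⟩

section CompactConvexSemigroup

variable {E : Type*} [AddCommGroup E] [Module ℝ E] [TopologicalSpace E] [T2Space E]

theorem exists_convex_isClosed_leftIdeal {𝒮 : Set (E → E)} (hcompact : IsCompact 𝒮)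
    (hconvex : Convex ℝ 𝒮) (hne : 𝒮.Nonempty) (hcomp : ∀ L ∈ 𝒮, ∀ M ∈ 𝒮, L ∘ M ∈ 𝒮) :
    ∃ J ⊆ 𝒮, IsClosed J ∧ Convex ℝ J ∧ J.Nonempty ∧ ∀ k ∈ J, (· ∘ k) '' 𝒮 = J := by
  obtain ⟨J, hJ𝒮, hJ⟩ := exists_minimal_isClosed_mapsTo hcompact hne ((fun L M => L ∘ M) '' 𝒮)
    (Set.forall_mem_image.mpr fun L hL M hM => hcomp L hL M hM)
  have hJideal : ∀ L ∈ 𝒮, ∀ k ∈ J, L ∘ k ∈ J := Set.forall_mem_image.mp hJ.prop.2.2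
  have himage : ∀ k ∈ J, (· ∘ k) '' 𝒮 = J := fun k hk => by
    refine hJ.eq_of_subset ⟨?_, hne.image _, ?_⟩
      (Set.image_subset_iff.mpr fun L hL => hJideal L hL k hk)
    · exact (hcompact.image (Pi.continuous_precomp k)).isClosed
    · rintro _ ⟨L, hL, rfl⟩ _ ⟨M, hM, rfl⟩
      exact ⟨L ∘ M, hcomp L hL M hM, rfl⟩
  obtain ⟨k, hk⟩ := hJ.prop.2.1
  refine ⟨J, hJ𝒮, hJ.prop.1, ?_, ⟨k, hk⟩, himage⟩
  rw [← himage k hk]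
  exact hconvex.is_linear_image ⟨fun _ _ => rfl, fun _ _ => rfl⟩

variable [IsTopologicalAddGroup E] [ContinuousSMul ℝ E] [LocallyConvexSpace ℝ E]

theorem exists_comp_comp_eq_of_isCompact_convex {𝒮 : Set (E → E)} (hcompact : IsCompact 𝒮)
    (hconvex : Convex ℝ 𝒮) (hne : 𝒮.Nonempty) (hcomp : ∀ L ∈ 𝒮, ∀ M ∈ 𝒮, L ∘ M ∈ 𝒮)
    (hlinear : ∀ L ∈ 𝒮, IsLinearMap ℝ L) : ∃ P ∈ 𝒮, ∀ L ∈ 𝒮, P ∘ L ∘ P = P := by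
  obtain ⟨J, hJ𝒮, hJclosed, hJconvex, hJne, hJ⟩ :=
    exists_convex_isClosed_leftIdeal hcompact hconvex hne hcomp
  have hideal : ∀ L ∈ 𝒮, ∀ k ∈ J, L ∘ k ∈ J := fun L hL k hk => hJ k hk ▸ ⟨L, hL, rfl⟩
  obtain ⟨P, hP⟩ := (hcompact.of_isClosed_subset hJclosed hJ𝒮).extremePoints_nonempty hJne
  obtain ⟨hPJ, hPext⟩ := mem_extremePoints.mp hP
  -- Writing `P = N ∘ (g + g ∘ g) / 2`, extremality forces `P = N ∘ g = N ∘ g ∘ g`.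
  have habsorb : ∀ g ∈ J, P ∘ g = P := by
    intro g hg
    have hgg := hideal g (hJ𝒮 hg) g hg
    have hk : (2⁻¹ : ℝ) • g + (2⁻¹ : ℝ) • g ∘ g ∈ J :=
      hJconvex hg hgg (by norm_num) (by norm_num) (by norm_num)
    obtain ⟨N, hN, hNP⟩ := (hJ _ hk).symm ▸ hPJ
    have hmid : (2⁻¹ : ℝ) • N ∘ g + (2⁻¹ : ℝ) • N ∘ g ∘ g = P := by
      rw [← hNP]
      ext x
      simp [(hlinear N hN).map_add, (hlinear N hN).map_smul]
    obtain ⟨hNg, hNgg⟩ := hPext _ (hideal N hN g hg) _ (hideal N hN _ hgg)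
      ⟨2⁻¹, 2⁻¹, by norm_num, by norm_num, by norm_num, hmid⟩
    rw [← Function.comp_assoc, hNg] at hNgg
    exact hNgg
  exact ⟨P, hJ𝒮 hPJ, fun L hL => habsorb _ (hideal L hL P hPJ)⟩

end CompactConvexSemigroup

namespace SemitopologicalSemihypergroup

section AveragingMaps

theorem apply_eq_of_mem_closedConvexHull {X : Type*} [NormedAddCommGroup X] [NormedSpace ℂ X]
    {M : StrongDual ℂ X} {A : Set X} {c : ℂ} (hA : ∀ f ∈ A, M f = c) {g : X}
    (hg : g ∈ closedConvexHull ℝ A) : M g = c :=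
  closedConvexHull_min hA
    ((convex_singleton c).is_linear_preimage (M.toLinearMap.restrictScalars ℝ).isLinear)
    (isClosed_singleton.preimage M.continuous) hg

/-- The averages of the operators `T_s`: the linear maps which send every point into the closed
convex hull of its orbit. They are regarded as plain functions, so that the ambient topology is that
of pointwise convergence. -/
def averagingMaps {K X : Type*} [NormedAddCommGroup X] [NormedSpace ℂ X] (T : K → X →L[ℂ] X) :
    Set (X → X) :=
  {L | IsLinearMap ℂ L ∧ ∀ f, L f ∈ closedConvexHull ℝ (Set.range fun s => T s f)}

theorem coe_mem_averagingMaps {K X : Type*} [NormedAddCommGroup X] [NormedSpace ℂ X]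
    (T : K → X →L[ℂ] X) (s : K) : ⇑(T s) ∈ averagingMaps T :=
  ⟨(T s).toLinearMap.isLinear, fun _ => subset_closedConvexHull ⟨s, rfl⟩⟩

theorem convex_averagingMaps {K X : Type*} [NormedAddCommGroup X] [NormedSpace ℂ X]
    (T : K → X →L[ℂ] X) : Convex ℝ (averagingMaps T) :=
  fun _ hL _ hM a b ha hb hab =>
    ⟨(a • hL.1.mk' + b • hM.1.mk').isLinear,
      fun f => convex_closedConvexHull (hL.2 f) (hM.2 f) ha hb hab⟩

variable {K : Type*} [TopologicalSpace K] [T2Space K] [LocallyCompactSpace K]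
    [MeasurableSpace K] [BorelSpace K] {S : SemitopologicalSemihypergroup K}
    {X : Type*} [NormedAddCommGroup X] [NormedSpace ℂ X] {T : K → X →L[ℂ] X}

theorem IsAlmostPeriodicRep.integrable (hT : S.IsAlmostPeriodicRep T) (f : X) (ν : Measure K)
    [IsFiniteMeasure ν] : Integrable (fun s => T s f) ν :=
  integrable_of_continuous_of_totallyBounded_range (hT.continuous_orbit f)
    (hT.totallyBounded_orbit f) ν

theorem IsAlmostPeriodicRep.norm_le_of_mem_closedConvexHull (hT : S.IsAlmostPeriodicRep T)
    {f g : X} (hg : g ∈ closedConvexHull ℝ (Set.range fun s => T s f)) : ‖g‖ ≤ ‖f‖ := by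
  rw [← mem_closedBall_zero_iff]
  refine closedConvexHull_min (Set.range_subset_iff.mpr fun s => ?_) (convex_closedBall 0 _)
    Metric.isClosed_closedBall hg
  exact mem_closedBall_zero_iff.mpr (hT.norm_apply_le s f)

variable [CompleteSpace X]

theorem IsAlmostPeriodicRep.mapsTo_closedConvexHull (hT : S.IsAlmostPeriodicRep T) (t : K)
    (f : X) : Set.MapsTo (T t) (closedConvexHull ℝ (Set.range fun s => T s f))
      (closedConvexHull ℝ (Set.range fun s => T s f)) := by
  have hmem (s : K) : T t (T s f) ∈ closedConvexHull ℝ (Set.range fun s => T s f) := by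
    rw [hT.comp]
    exact convex_closedConvexHull.integral_mem isClosed_closedConvexHull
      (.of_forall fun ζ => subset_closedConvexHull ⟨ζ, rfl⟩) (hT.integrable f _)
  exact closedConvexHull_min (Set.range_subset_iff.mpr hmem)
    (convex_closedConvexHull.is_linear_preimage ((T t).toLinearMap.restrictScalars ℝ).isLinear)
    (isClosed_closedConvexHull.preimage (T t).continuous)

theorem IsAlmostPeriodicRep.comp_mem_averagingMaps (hT : S.IsAlmostPeriodicRep T) {L M : X → X}
    (hL : L ∈ averagingMaps T) (hM : M ∈ averagingMaps T) : L ∘ M ∈ averagingMaps T := by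
  refine ⟨(hL.1.mk' ∘ₗ hM.1.mk').isLinear, fun f => ?_⟩
  exact closedConvexHull_min
    (Set.range_subset_iff.mpr fun s => hT.mapsTo_closedConvexHull s f (hM.2 f))
    convex_closedConvexHull isClosed_closedConvexHull (hL.2 (M f))

theorem IsAlmostPeriodicRep.isCompact_averagingMaps (hT : S.IsAlmostPeriodicRep T) :
    IsCompact (averagingMaps T) := by
  have hhull : ∀ f, IsCompact (closedConvexHull ℝ (Set.range fun s => T s f)) := fun f => by
    rw [closedConvexHull_eq_closure_convexHull]
    exact (hT.totallyBounded_orbit f).convexHull.closure.isCompact_of_isClosed isClosed_closure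
  have heq : averagingMaps T = Set.univ.pi (fun f => closedConvexHull ℝ (Set.range fun s => T s f))
      ∩ Set.range ((↑) : (X →ₗ[ℂ] X) → X → X) := by
    ext L
    refine ⟨fun hL => ⟨fun f _ => hL.2 f, hL.1.mk', rfl⟩, ?_⟩
    rintro ⟨hL, L, rfl⟩
    exact ⟨L.isLinear, fun f => hL f trivial⟩
  rw [heq]
  exact (isCompact_univ_pi hhull).inter_right (LinearMap.isClosed_range_coe X X (RingHom.id ℂ))

theorem IsAlmostPeriodicRep.exists_average [Nonempty K] (hT : S.IsAlmostPeriodicRep T) :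
    ∃ P : X →L[ℂ] X, (∀ f, P f ∈ closedConvexHull ℝ (Set.range fun s => T s f)) ∧
      ∀ s f, P (T s (P f)) = P f := by
  obtain ⟨P, hP, hPTP⟩ := exists_comp_comp_eq_of_isCompact_convex hT.isCompact_averagingMaps
    (convex_averagingMaps T) ⟨_, coe_mem_averagingMaps T (Classical.arbitrary K)⟩
    (fun _ hL _ hM => hT.comp_mem_averagingMaps hL hM)
    fun _ hL => (hL.1.mk'.restrictScalars ℝ).isLinear
  refine ⟨hP.1.mk'.mkContinuous 1 fun f => ?_, hP.2, fun s f => ?_⟩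
  · rw [one_mul]
    exact hT.norm_le_of_mem_closedConvexHull (hP.2 f)
  · exact congrFun (hPTP _ (coe_mem_averagingMaps T s)) f

end AveragingMaps

section Coefficients

variable {K : Type*} [TopologicalSpace K] {X : Type*} [NormedAddCommGroup X] [NormedSpace ℂ X]

/-- The coefficients `s ↦ ω_s(φ)` of a norm bounded and weak* continuous family `ω` of functionals,
as a function of `φ`. -/
noncomputable def coefficientMap (ω : K → WeakDual ℂ X) (hω : Continuous ω) (R : ℝ≥0)
    (hR : ∀ s φ, ‖ω s φ‖ ≤ R * ‖φ‖) : X →L[ℂ] (K →ᵇ ℂ) :=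
  LinearMap.mkContinuous
    { toFun φ := .ofNormedAddCommGroup (fun s => ω s φ) ((WeakDual.eval_continuous φ).comp hω)
        (R * ‖φ‖) fun s => hR s φ
      map_add' φ φ' := by
        ext s
        exact map_add (ω s) φ φ'
      map_smul' c φ := by
        ext s
        exact map_smul (ω s) c φ }
    R fun φ => BoundedContinuousFunction.norm_ofNormedAddCommGroup_le _ (by positivity)
      fun s => hR s φ

theorem coefficientMap_apply {ω : K → WeakDual ℂ X} (hω : Continuous ω) {R : ℝ≥0}
    (hR : ∀ s φ, ‖ω s φ‖ ≤ R * ‖φ‖) (φ : X) (s : K) : coefficientMap ω hω R hR φ s = ω s φ := rfl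

end Coefficients

variable {K : Type*} [TopologicalSpace K] [T2Space K] [LocallyCompactSpace K]
    [MeasurableSpace K] [BorelSpace K] {S : SemitopologicalSemihypergroup K}

section RepCoefficients

variable {X : Type*} [NormedAddCommGroup X] [NormedSpace ℂ X] {T : K → X →L[ℂ] X}

/-- The coefficients `s ↦ ψ(T_s f)` of a representation, as a function of `f`. -/
noncomputable def IsAlmostPeriodicRep.coefficientMap (hT : S.IsAlmostPeriodicRep T)
    (ψ : StrongDual ℂ X) : X →L[ℂ] (K →ᵇ ℂ) :=
  SemitopologicalSemihypergroup.coefficientMap (fun s => StrongDual.toWeakDual (ψ ∘L T s))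
    (WeakDual.continuous_of_continuous_eval fun f => ψ.continuous.comp (hT.continuous_orbit f))
    ‖ψ‖₊ fun s f => ψ.le_opNorm_of_le (hT.norm_apply_le s f)

theorem IsAlmostPeriodicRep.coefficientMap_apply (hT : S.IsAlmostPeriodicRep T)
    (ψ : StrongDual ℂ X) (f : X) (s : K) : hT.coefficientMap ψ f s = ψ (T s f) := rfl

variable [CompleteSpace X]

theorem IsAlmostPeriodicRep.translate_coefficientMap (hT : S.IsAlmostPeriodicRep T)
    (ψ : StrongDual ℂ X) (x : K) (f : X) :
    S.translate x (hT.coefficientMap ψ f) = hT.coefficientMap ψ (T x f) := by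
  ext y
  rw [coefficientMap_apply, hT.comp]
  exact ψ.integral_comp_comm (hT.integrable f _)

theorem IsAlmostPeriodicRep.coefficientMap_mem_AP (hT : S.IsAlmostPeriodicRep T)
    (ψ : StrongDual ℂ X) (f : X) : hT.coefficientMap ψ f ∈ S.AP := by
  simp only [mem_AP_iff, hT.translate_coefficientMap]
  rw [← Function.comp_def, Set.range_comp]
  exact (hT.totallyBounded_orbit f).image (hT.coefficientMap ψ).uniformContinuous

end RepCoefficients

theorem isLeftAmenableAP_of_norm_le [Nonempty K] {φ : StrongDual ℂ S.AP}
    (hφ : ∀ f, ‖φ f‖ ≤ ‖f‖) (hone : φ ⟨1, S.one_mem_AP⟩ = 1)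
    (hinv : ∀ x f, φ (S.translateAP x f) = φ f) : S.IsLeftAmenableAP := by
  refine ⟨φ, ⟨le_antisymm ?_ ?_, hone⟩, fun x f => ⟨S.translateAP x f, rfl, hinv x f⟩⟩
  · exact φ.opNorm_le_bound zero_le_one fun f => (one_mul ‖f‖).symm ▸ hφ f
  · have hnorm : ‖(⟨1, S.one_mem_AP⟩ : S.AP)‖ = 1 := norm_one (α := K →ᵇ ℂ)
    simpa only [hone, hnorm, norm_one, mul_one] using φ.le_opNorm ⟨1, S.one_mem_AP⟩

theorem isLeftAmenableAP_of_invariant [Nonempty K] {m : StrongDual ℂ S.AP}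
    (hone : m ⟨1, S.one_mem_AP⟩ = 1) (hinv : ∀ x f, m (S.translateAP x f) = m f) :
    S.IsLeftAmenableAP := by
  have hT := isAlmostPeriodicRep_translateAP (S := S)
  obtain ⟨P, hP, hPTP⟩ := hT.exists_average
  let φ : StrongDual ℂ S.AP :=
    BoundedContinuousFunction.evalCLM ℂ (Classical.arbitrary K) ∘L S.AP.subtypeL ∘L P
  let c : S.AP →L[ℂ] S.AP := (hT.coefficientMap φ).codRestrict S.AP (hT.coefficientMap_mem_AP φ)
  have hcT (x : K) (f : S.AP) : c (S.translateAP x f) = S.translateAP x (c f) :=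
    Subtype.ext (hT.translate_coefficientMap φ x f).symm
  have hcP (f : S.AP) : c (P f) = φ f • ⟨1, S.one_mem_AP⟩ := by
    ext s
    have hs : (c (P f) : K →ᵇ ℂ) s = φ (S.translateAP s (P f)) := rfl
    simp [hs, φ, hPTP]
  have hφ (f : S.AP) : φ f = m (c f) := calc
    φ f = m (φ f • ⟨1, S.one_mem_AP⟩) := by rw [map_smul, hone, smul_eq_mul, mul_one]
    _ = m (c (P f)) := by rw [hcP]
    _ = m (c f) := apply_eq_of_mem_closedConvexHull (M := m ∘L c)
      (Set.forall_mem_range.mpr fun x => (congrArg m (hcT x f)).trans (hinv x (c f))) (hP f)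
  refine isLeftAmenableAP_of_norm_le (φ := φ) (fun f => ?_) ?_ fun x f => by
    rw [hφ, hφ, hcT, hinv]
  · exact (BoundedContinuousFunction.norm_coe_le_norm _ _).trans
      (hT.norm_le_of_mem_closedConvexHull (hP f))
  · have hPone : P ⟨1, S.one_mem_AP⟩ = ⟨1, S.one_mem_AP⟩ := by
      refine closedConvexHull_min (Set.range_subset_iff.mpr fun s => ?_)
        (convex_singleton _) isClosed_singleton (hP _)
      exact Subtype.ext (S.translate_one s)
    simp [φ, hPone]

end SemitopologicalSemihypergroup

/-! ### From fixed points to invariant means -/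

namespace SemitopologicalSemihypergroup

/-- Every separately continuous, equicontinuous, affine action of `K` on the dual of `X` with a norm
bounded orbit has a common fixed point. -/
def HasDualFixedPointProperty {K : Type*} [TopologicalSpace K] [T2Space K] [LocallyCompactSpace K]
    [MeasurableSpace K] [BorelSpace K] (S : SemitopologicalSemihypergroup K) (X : Type*)
    [NormedAddCommGroup X] [NormedSpace ℂ X] : Prop :=
  ∀ π : K → WeakDual ℂ X → WeakDual ℂ X,
    S.IsDualAction π → IsSeparatelyContinuousAction π → IsEquicontinuousAction π →
    IsAffineAction π →
    (∃ ω₀ : WeakDual ℂ X, Bornology.IsBounded (Set.range fun s : K => π s ω₀)) →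
    ∃ x₀ : WeakDual ℂ X, ∀ s : K, π s x₀ = x₀

section WeakStarBounded

variable {X : Type*} [NormedAddCommGroup X] [NormedSpace ℂ X]

theorem exists_norm_apply_le_of_isBounded {B : Set (WeakDual ℂ X)} (hB : Bornology.IsBounded B) :
    ∃ R > 0, ∀ u ∈ B, ∀ φ, ‖u φ‖ ≤ R * ‖φ‖ := by
  obtain ⟨R, hRpos, hR⟩ :=
    (WeakDual.isBounded_toWeakDual_preimage_iff_isBounded.mpr hB).exists_pos_norm_le
  exact ⟨R, hRpos, fun u hu => (WeakDual.toStrongDual u).le_of_opNorm_le (hR _ hu)⟩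

theorem exists_nhds_zero_forall_norm_apply_lt {B : Set (WeakDual ℂ X)}
    (hB : Bornology.IsBounded B) {A : Set X} (hA : TotallyBounded A) {ε : ℝ} (hε : 0 < ε) :
    ∃ V ∈ 𝓝 (0 : WeakDual ℂ X), ∀ w ∈ B, w ∈ V → ∀ φ ∈ A, ‖w φ‖ < ε := by
  obtain ⟨R, hRpos, hR⟩ := exists_norm_apply_le_of_isBounded hB
  obtain ⟨t, ht, hAt⟩ := Metric.totallyBounded_iff.mp hA (ε / 2 / R) (by positivity)
  refine ⟨⋂ z ∈ t, {w | ‖w z‖ < ε / 2}, (Filter.biInter_mem ht).mpr fun z _ => ?_, ?_⟩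
  · refine (isOpen_lt (WeakDual.eval_continuous z).norm continuous_const).mem_nhds ?_
    exact norm_zero.trans_lt (half_pos hε)
  · intro w hwB hwV φ hφ
    obtain ⟨z, hz, hφz⟩ := Set.mem_iUnion₂.mp (hAt hφ)
    rw [mem_ball_iff_norm, lt_div_iff₀' hRpos] at hφz
    calc ‖w φ‖ = ‖w (φ - z) + w z‖ := by rw [← map_add, sub_add_cancel]
      _ ≤ R * ‖φ - z‖ + ‖w z‖ := norm_add_le_of_le (hR w hwB _) le_rfl
      _ < ε / 2 + ε / 2 := add_lt_add hφz (Set.mem_iInter₂.mp hwV z hz)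
      _ = ε := add_halves ε

theorem isEquicontinuousAction_of_totallyBounded [CompleteSpace X] {K : Type*}
    {π : K → WeakDual ℂ X → WeakDual ℂ X} {A : K → X → X}
    (hA : ∀ φ, TotallyBounded (Set.range fun s => A s φ))
    (hπ : ∀ s x y φ, (π s y - π s x) φ = (y - x) (A s φ)) : IsEquicontinuousAction π := by
  intro C hC x hx U hU
  obtain ⟨F, ε, hε, hFU⟩ := ((WeakDual.withSeminorms ℂ X).mem_nhds_iff 0 U).mp hU
  have hCC : Bornology.IsBounded (C - C) := WeakDual.isBounded_iff_isVonNBounded.mpr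
    ((hC.isVonNBounded ℂ).sub (hC.isVonNBounded ℂ))
  choose V hV hVA using fun φ => exists_nhds_zero_forall_norm_apply_lt hCC (hA φ) hε
  refine ⟨⋂ φ ∈ F, V φ, (Filter.biInter_finset_mem F).mpr fun φ _ => hV φ, fun y hy hyx s => ?_⟩
  refine hFU ((Seminorm.mem_ball_zero _).mpr (Seminorm.finset_sup_apply_lt hε fun φ hφ => ?_))
  have hlt := hVA φ _ (Set.sub_mem_sub hy hx) (Set.mem_iInter₂.mp hyx φ hφ) _ ⟨s, rfl⟩
  rwa [← hπ] at hlt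

end WeakStarBounded

section ShiftedAdjoint

variable {X : Type*} [NormedAddCommGroup X] [NormedSpace ℂ X]

/-- The affine action `u ↦ T_s* (u + (1 - u(e)) m₀) - (1 - u(e)) m₀` on the dual of `X`: on the
hyperplane `u(e) = c` it is the adjoint action conjugated by the shift by `(1 - c) m₀`, which leads
to the hyperplane `u(e) = 1` if `m₀(e) = 1`. -/
noncomputable def shiftedAdjoint {K : Type*} (T : K → X →L[ℂ] X) (e : X) (m₀ : StrongDual ℂ X)
    (s : K) (u : WeakDual ℂ X) : WeakDual ℂ X :=
  StrongDual.toWeakDual (WeakDual.toStrongDual u ∘L T s + (1 - u e) • (m₀ ∘L T s - m₀))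

theorem shiftedAdjoint_apply {K : Type*} (T : K → X →L[ℂ] X) (e : X) (m₀ : StrongDual ℂ X)
    (s : K) (u : WeakDual ℂ X) (φ : X) :
    shiftedAdjoint T e m₀ s u φ = u (T s φ) + (1 - u e) * (m₀ (T s φ) - m₀ φ) := rfl

theorem isAffineAction_shiftedAdjoint {K : Type*} (T : K → X →L[ℂ] X) (e : X)
    (m₀ : StrongDual ℂ X) : IsAffineAction (shiftedAdjoint T e m₀) := by
  intro s u v a b _ _ hab
  have hab' : (a : ℂ) + b = 1 := by exact_mod_cast hab
  refine DFunLike.ext _ _ fun φ => ?_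
  change (a * u (T s φ) + b * v (T s φ)) + (1 - (a * u e + b * v e)) * (m₀ (T s φ) - m₀ φ) =
    a * (u (T s φ) + (1 - u e) * (m₀ (T s φ) - m₀ φ)) +
    b * (v (T s φ) + (1 - v e) * (m₀ (T s φ) - m₀ φ))
  linear_combination (-(m₀ (T s φ) - m₀ φ)) * hab'

variable {K : Type*} [TopologicalSpace K] [T2Space K] [LocallyCompactSpace K]
    [MeasurableSpace K] [BorelSpace K] {S : SemitopologicalSemihypergroup K}
    {T : K → X →L[ℂ] X}

theorem IsAlmostPeriodicRep.isSeparatelyContinuousAction_shiftedAdjoint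
    (hT : S.IsAlmostPeriodicRep T) (e : X) (m₀ : StrongDual ℂ X) :
    IsSeparatelyContinuousAction (shiftedAdjoint T e m₀) := by
  constructor
  · intro s
    refine WeakDual.continuous_of_continuous_eval fun φ => ?_
    exact (WeakDual.eval_continuous _).add
      ((continuous_const.sub (WeakDual.eval_continuous e)).mul continuous_const)
  · intro u
    refine WeakDual.continuous_of_continuous_eval fun φ => ?_
    exact ((WeakDual.toStrongDual u).continuous.comp (hT.continuous_orbit φ)).add
      (continuous_const.mul ((m₀.continuous.comp (hT.continuous_orbit φ)).sub continuous_const))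

theorem IsAlmostPeriodicRep.isBounded_shiftedAdjoint_zero (hT : S.IsAlmostPeriodicRep T) (e : X)
    (m₀ : StrongDual ℂ X) :
    Bornology.IsBounded (Set.range fun s => shiftedAdjoint T e m₀ s 0) := by
  refine (WeakDual.isBounded_closedBall (0 : StrongDual ℂ X) (‖m₀‖ + ‖m₀‖)).subset ?_
  rintro _ ⟨s, rfl⟩
  refine mem_closedBall_zero_iff.mpr (ContinuousLinearMap.opNorm_le_bound _ (by positivity)
    fun φ => ?_)
  calc ‖(0 : ℂ) + (1 - 0) * (m₀ (T s φ) - m₀ φ)‖ = ‖m₀ (T s φ) - m₀ φ‖ := by ring_nf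
    _ ≤ ‖m₀‖ * ‖φ‖ + ‖m₀‖ * ‖φ‖ :=
      norm_sub_le_of_le (m₀.le_opNorm_of_le (hT.norm_apply_le s φ)) (m₀.le_opNorm φ)
    _ = (‖m₀‖ + ‖m₀‖) * ‖φ‖ := (add_mul _ _ _).symm

variable [CompleteSpace X]

theorem IsAlmostPeriodicRep.isEquicontinuousAction_shiftedAdjoint (hT : S.IsAlmostPeriodicRep T)
    (e : X) (m₀ : StrongDual ℂ X) : IsEquicontinuousAction (shiftedAdjoint T e m₀) := by
  refine isEquicontinuousAction_of_totallyBounded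
    (A := fun s φ => T s φ - m₀.smulRight e (T s φ) + m₀ φ • e) (fun φ => ?_) fun s x y φ => ?_
  · have hA : UniformContinuous fun f : X => f - m₀.smulRight e f + m₀ φ • e :=
      (uniformContinuous_id.sub (m₀.smulRight e).uniformContinuous).add uniformContinuous_const
    have himage := (hT.totallyBounded_orbit φ).image hA
    rwa [← Set.range_comp] at himage
  · have hsub (f : X) : (y - x) f = y f - x f := rfl
    have hsub' : (shiftedAdjoint T e m₀ s y - shiftedAdjoint T e m₀ s x) φ =
      shiftedAdjoint T e m₀ s y φ - shiftedAdjoint T e m₀ s x φ := rfl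
    simp only [hsub', shiftedAdjoint_apply, map_add, map_sub, map_smul, hsub, smul_eq_mul,
      ContinuousLinearMap.smulRight_apply]
    ring

theorem IsAlmostPeriodicRep.isDualAction_shiftedAdjoint (hT : S.IsAlmostPeriodicRep T) {e : X}
    (he : ∀ s, T s e = e) (m₀ : StrongDual ℂ X) : S.IsDualAction (shiftedAdjoint T e m₀) := by
  constructor
  · intro s t u φ
    have hcoeff (ψ : StrongDual ℂ X) : Integrable (fun ζ => ψ (T ζ φ)) (S.convMeasure s t) ∧
        ∫ ζ, ψ (T ζ φ) ∂S.convMeasure s t = ψ (T t (T s φ)) := by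
      rw [hT.comp]
      exact ⟨ψ.integrable_comp (hT.integrable φ _), ψ.integral_comp_comm (hT.integrable φ _)⟩
    obtain ⟨hu, hu'⟩ := hcoeff (WeakDual.toStrongDual u)
    obtain ⟨hm₀, hm₀'⟩ := hcoeff m₀
    have hshift := (hm₀.sub (integrable_const (m₀ φ))).const_mul (1 - u e)
    refine ⟨hu.add hshift, ?_⟩
    symm
    calc ∫ ζ, shiftedAdjoint T e m₀ ζ u φ ∂S.convMeasure s t
      _ = u (T t (T s φ)) + (1 - u e) * (m₀ (T t (T s φ)) - m₀ φ) := by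
        refine (integral_add hu hshift).trans (congrArg₂ _ hu' ?_)
        rw [integral_const_mul]
        simp [integral_sub hm₀ (integrable_const _), hm₀']
      _ = shiftedAdjoint T e m₀ s (shiftedAdjoint T e m₀ t u) φ := by
        simp only [shiftedAdjoint_apply, he]
        ring
  · intro a ha u
    refine DFunLike.ext _ _ fun φ => ?_
    rw [shiftedAdjoint_apply, hT.apply_of_isTwoSidedIdentity a ha, sub_self, mul_zero, add_zero]

theorem IsAlmostPeriodicRep.exists_invariant_functional (hT : S.IsAlmostPeriodicRep T)
    (hfix : S.HasDualFixedPointProperty X) {e : X} (he : ∀ s, T s e = e) {m₀ : StrongDual ℂ X}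
    (hm₀ : m₀ e = 1) : ∃ m : StrongDual ℂ X, m e = 1 ∧ ∀ s φ, m (T s φ) = m φ := by
  obtain ⟨u, hu⟩ := hfix (shiftedAdjoint T e m₀) (hT.isDualAction_shiftedAdjoint he m₀)
    (hT.isSeparatelyContinuousAction_shiftedAdjoint e m₀)
    (hT.isEquicontinuousAction_shiftedAdjoint e m₀) (isAffineAction_shiftedAdjoint T e m₀)
    ⟨0, hT.isBounded_shiftedAdjoint_zero e m₀⟩
  refine ⟨WeakDual.toStrongDual u + (1 - u e) • m₀, ?_, fun s φ => ?_⟩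
  · change u e + (1 - u e) * m₀ e = 1
    rw [hm₀]
    ring
  · have hfixed := DFunLike.congr_fun (hu s) φ
    rw [shiftedAdjoint_apply] at hfixed
    change u (T s φ) + (1 - u e) * m₀ (T s φ) = u φ + (1 - u e) * m₀ φ
    linear_combination hfixed

end ShiftedAdjoint

variable {K : Type u} [TopologicalSpace K] [T2Space K] [LocallyCompactSpace K]
    [MeasurableSpace K] [BorelSpace K] {S : SemitopologicalSemihypergroup K}

theorem IsAlmostPeriodicRep.conj {X Y : Type*} [NormedAddCommGroup X] [NormedSpace ℂ X]
    [NormedAddCommGroup Y] [NormedSpace ℂ Y] {T : K → X →L[ℂ] X}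
    (hT : S.IsAlmostPeriodicRep T) (j : X ≃ₗᵢ[ℂ] Y) :
    S.IsAlmostPeriodicRep fun s =>
      (j.toContinuousLinearEquiv : X →L[ℂ] Y) ∘L T s ∘L
        (j.symm.toContinuousLinearEquiv : Y →L[ℂ] X) where
  norm_apply_le s f := by
    simpa using hT.norm_apply_le s (j.symm f)
  totallyBounded_orbit f := by
    have himage := (hT.totallyBounded_orbit (j.symm f)).image j.isometry.uniformContinuous
    rwa [← Set.range_comp] at himage
  continuous_orbit f := j.continuous.comp (hT.continuous_orbit (j.symm f))
  comp s t f := by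
    simpa [hT.comp] using (j.toContinuousLinearEquiv.integral_comp_comm _).symm
  apply_of_isTwoSidedIdentity e he f := by
    simp [hT.apply_of_isTwoSidedIdentity e he]

theorem isLeftAmenableAP_of_fixedPointProperty [Nonempty K]
    (hfix : ∀ (X : Type (max u v)) [NormedAddCommGroup X] [NormedSpace ℂ X] [CompleteSpace X],
      S.HasDualFixedPointProperty X) : S.IsLeftAmenableAP := by
  let up : S.AP ≃ₗᵢ[ℂ] ULift.{v} S.AP :=
    { ULift.moduleEquiv.symm with norm_map' := fun _ => rfl }
  have : CompleteSpace (ULift.{v} S.AP) := up.symm.toIsometryEquiv.completeSpace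
  let m₀ : StrongDual ℂ (ULift.{v} S.AP) :=
    BoundedContinuousFunction.evalCLM ℂ (Classical.arbitrary K) ∘L S.AP.subtypeL ∘L
      (up.symm.toContinuousLinearEquiv : ULift.{v} S.AP →L[ℂ] S.AP)
  obtain ⟨m, hone, hinv⟩ := (isAlmostPeriodicRep_translateAP.conj up).exists_invariant_functional
    (hfix _) (e := up ⟨1, S.one_mem_AP⟩) (m₀ := m₀)
    (fun s => congrArg up (Subtype.ext (S.translate_one s))) rfl
  exact isLeftAmenableAP_of_invariant
    (m := m ∘L (up.toContinuousLinearEquiv : S.AP →L[ℂ] ULift.{v} S.AP)) hone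
    fun x f => hinv x (up f)

end SemitopologicalSemihypergroup

/-! ### From invariant means to fixed points -/

theorem totallyBounded_range_of_equicontinuous {ι C : Type*} [TopologicalSpace C]
    [CompactSpace C] {F : ι → C →ᵇ ℂ} (hF : Equicontinuous fun i => ⇑(F i)) {B : ℝ}
    (hB : ∀ i u, ‖F i u‖ ≤ B) : TotallyBounded (Set.range F) := by
  refine (BoundedContinuousFunction.arzela_ascoli (Metric.closedBall 0 B)
    (isCompact_closedBall 0 B) (Set.range F) ?_ ?_).totallyBounded.subset subset_closure
  · rintro _ u ⟨i, rfl⟩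
    exact mem_closedBall_zero_iff.mpr (hB i u)
  · rintro x U hU
    filter_upwards [hF x U hU] with y hy
    rintro ⟨_, i, rfl⟩
    exact hy i

theorem exists_eq_add_re_apply {X : Type*} [NormedAddCommGroup X] [NormedSpace ℂ X]
    {G : WeakDual ℂ X → ℝ} (hG : Continuous G)
    (hmid : ∀ u v, G (((1 / 2 : ℝ) : ℂ) • u + ((1 / 2 : ℝ) : ℂ) • v) = (G u + G v) / 2) :
    ∃ ψ : X, ∀ u, G u = G 0 + (u ψ).re := by
  have : IsScalarTower ℝ ℂ (WeakDual ℂ X) :=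
    ⟨fun a c u => DFunLike.ext _ _ fun φ => smul_assoc a c (u φ)⟩
  have hmidpoint (u v : WeakDual ℂ X) :
      midpoint ℝ u v = ((1 / 2 : ℝ) : ℂ) • u + ((1 / 2 : ℝ) : ℂ) • v := by
    rw [midpoint_eq_smul_add, smul_add, ← algebraMap_smul ℂ, ← algebraMap_smul ℂ (⅟2 : ℝ) v]
    simp
  let ℓ : WeakDual ℂ X →+ ℝ :=
    AddMonoidHom.ofMapMidpoint ℝ ℝ (fun u => G u - G 0) (sub_self _) fun u v => by
      rw [hmidpoint, hmid, midpoint_eq_smul_add, invOf_eq_inv, smul_eq_mul]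
      ring
  let ℓ' : StrongDual ℝ (WeakDual ℂ X) := ℓ.toRealLinearMap (hG.sub continuous_const)
  obtain ⟨ψ, hψ⟩ := LinearMap.dualEmbedding_surjective (topDualPairing ℂ X)
    (StrongDual.extendRCLike (𝕜 := ℂ) ℓ')
  refine ⟨ψ, fun u => ?_⟩
  have hre : (u ψ).re = G u - G 0 :=
    (congrArg Complex.re (DFunLike.congr_fun hψ u)).trans
      (StrongDual.re_extendRCLike_apply (𝕜 := ℂ) ℓ' u)
  rw [hre, add_sub_cancel]

namespace SemitopologicalSemihypergroup

variable {K : Type*} [TopologicalSpace K] [T2Space K] [LocallyCompactSpace K]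
    [MeasurableSpace K] [BorelSpace K] {S : SemitopologicalSemihypergroup K}

theorem IsLeftAmenableAP.exists_mean (hS : S.IsLeftAmenableAP) :
    ∃ m : StrongDual ℂ S.AP, S.IsMean m ∧ ∀ x f, m (S.translateAP x f) = m f := by
  obtain ⟨m, hm, hinv⟩ := hS
  refine ⟨m, hm, fun x f => ?_⟩
  obtain ⟨g, hg, hmg⟩ := hinv x f
  rw [← hmg, Subtype.ext (DFunLike.coe_injective hg.symm : (S.translateAP x f : K →ᵇ ℂ) = g)]

theorem norm_smul_one_add_sq_le {h : S.AP} (hh : ∀ s, ((h : K →ᵇ ℂ) s).re = 0) (t : ℝ) :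
    ‖(t : ℂ) • (⟨1, S.one_mem_AP⟩ : S.AP) + h‖ ^ 2 ≤ t ^ 2 + ‖h‖ ^ 2 := by
  refine (Real.le_sqrt (norm_nonneg _) (by positivity)).mp ?_
  refine (BoundedContinuousFunction.norm_le (Real.sqrt_nonneg _)).mpr fun s => ?_
  refine Real.le_sqrt_of_sq_le ?_
  calc ‖(t : ℂ) * 1 + (h : K →ᵇ ℂ) s‖ ^ 2 = t ^ 2 + ‖(h : K →ᵇ ℂ) s‖ ^ 2 := by
        simp only [mul_one, Complex.sq_norm, Complex.normSq_apply, Complex.add_re, Complex.add_im,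
          Complex.ofReal_re, Complex.ofReal_im, hh s]
        ring
    _ ≤ t ^ 2 + ‖h‖ ^ 2 := by
        gcongr
        exact (h : K →ᵇ ℂ).norm_coe_le_norm s

theorem IsMean.re_apply_eq_zero {m : StrongDual ℂ S.AP} (hm : S.IsMean m) {h : S.AP}
    (hh : ∀ s, ((h : K →ᵇ ℂ) s).re = 0) : (m h).re = 0 := by
  have hsq (t : ℝ) : (t + (m h).re) ^ 2 ≤ t ^ 2 + ‖h‖ ^ 2 := by
    have hle : ‖t + m h‖ ≤ ‖(t : ℂ) • (⟨1, S.one_mem_AP⟩ : S.AP) + h‖ := by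
      have hop := m.le_opNorm ((t : ℂ) • (⟨1, S.one_mem_AP⟩ : S.AP) + h)
      rwa [map_add, map_smul, hm.2, hm.1, one_mul, smul_eq_mul, mul_one] at hop
    calc (t + (m h).re) ^ 2 = |(t + m h).re| ^ 2 := by simp
      _ ≤ ‖t + m h‖ ^ 2 := by
        gcongr
        exact Complex.abs_re_le_norm _
      _ ≤ ‖(t : ℂ) • (⟨1, S.one_mem_AP⟩ : S.AP) + h‖ ^ 2 := by gcongr
      _ ≤ t ^ 2 + ‖h‖ ^ 2 := norm_smul_one_add_sq_le hh t
  by_contra hne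
  have hlin : 2 * ((‖h‖ ^ 2 + 1) / (2 * (m h).re)) * (m h).re = ‖h‖ ^ 2 + 1 := by field_simp
  nlinarith [hsq ((‖h‖ ^ 2 + 1) / (2 * (m h).re)), sq_nonneg (m h).re]

variable {X : Type*} [NormedAddCommGroup X] [NormedSpace ℂ X]

section WeakStarMean

variable {m : StrongDual ℂ S.AP} {ω : K → WeakDual ℂ X} {c : X →L[ℂ] S.AP}

theorem IsMean.re_apply_eq_of_midpoint (hm : S.IsMean m)
    (hc : ∀ φ s, (c φ : K →ᵇ ℂ) s = ω s φ) {G : WeakDual ℂ X → ℝ} (hG : Continuous G)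
    (hmid : ∀ u v, G (((1 / 2 : ℝ) : ℂ) • u + ((1 / 2 : ℝ) : ℂ) • v) = (G u + G v) / 2)
    {k : S.AP} (hk : ∀ s, ((k : K →ᵇ ℂ) s).re = G (ω s)) :
    G (StrongDual.toWeakDual (m ∘L c)) = (m k).re := by
  obtain ⟨ψ, hψ⟩ := exists_eq_add_re_apply hG hmid
  have hre := hm.re_apply_eq_zero (h := k - (G 0 : ℂ) • ⟨1, S.one_mem_AP⟩ - c ψ) fun s => by
    change ((k : K →ᵇ ℂ) s - (G 0 : ℂ) * 1 - (c ψ : K →ᵇ ℂ) s).re = 0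
    simp [hk, hc, hψ (ω s)]
  have hx₀ : StrongDual.toWeakDual (m ∘L c) ψ = m (c ψ) := rfl
  rw [map_sub, map_sub, map_smul, hm.2, smul_eq_mul, mul_one, Complex.sub_re, Complex.sub_re,
    Complex.ofReal_re] at hre
  rw [hψ, hx₀]
  linarith

theorem IsMean.apply_eq_of_midpoint (hm : S.IsMean m)
    (hc : ∀ φ s, (c φ : K →ᵇ ℂ) s = ω s φ) {G : WeakDual ℂ X → ℂ} (hG : Continuous G)
    (hmid : ∀ u v, G (((1 / 2 : ℝ) : ℂ) • u + ((1 / 2 : ℝ) : ℂ) • v) = (G u + G v) / 2)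
    {k : S.AP} (hk : ∀ s, (k : K →ᵇ ℂ) s = G (ω s)) :
    G (StrongDual.toWeakDual (m ∘L c)) = m k := by
  have hre := hm.re_apply_eq_of_midpoint hc (Complex.continuous_re.comp hG)
    (fun u v => by rw [Function.comp_apply, hmid]; simp) fun s => congrArg Complex.re (hk s)
  have him := hm.re_apply_eq_of_midpoint hc (k := -Complex.I • k) (Complex.continuous_im.comp hG)
    (fun u v => by rw [Function.comp_apply, hmid]; simp) fun s => by
      change (-Complex.I * (k : K →ᵇ ℂ) s).re = _
      simp [hk]
  exact Complex.ext hre (him.trans (by simp))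

end WeakStarMean

section Orbits

variable {π : K → WeakDual ℂ X → WeakDual ℂ X} {ω₀ : WeakDual ℂ X} {φ : X} {f : K →ᵇ ℂ}

theorem equicontinuous_coefficients {K : Type*} {π : K → WeakDual ℂ X → WeakDual ℂ X}
    (heq : IsEquicontinuousAction π) {C : Set (WeakDual ℂ X)} (hC : IsCompact C) (φ : X) :
    Equicontinuous fun (a : K) (u : C) => π a u φ := by
  intro x
  rw [Metric.equicontinuousAt_iff_right]
  intro ε hε
  have hU : {w : WeakDual ℂ X | ‖w φ‖ < ε} ∈ 𝓝 0 :=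
    (isOpen_lt (WeakDual.eval_continuous φ).norm continuous_const).mem_nhds
      (norm_zero.trans_lt hε)
  obtain ⟨V, hV, hVU⟩ := heq C hC x x.2 _ hU
  have hsub : Filter.Tendsto (fun y : C => (y : WeakDual ℂ X) - x) (𝓝 x) (𝓝 0) :=
    (continuous_subtype_val.sub continuous_const).tendsto' x 0 (sub_self _)
  filter_upwards [hsub hV] with y hy a
  rw [dist_comm, dist_eq_norm]
  exact hVU y y.2 hy a

theorem IsDualAction.translate_apply (hπ : S.IsDualAction π) (hf : ∀ s, f s = π s ω₀ φ)
    (a s : K) : S.translate a f s = π a (π s ω₀) φ := by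
  rw [(hπ.comp a s ω₀ φ).2, SemitopologicalSemihypergroup.translate_apply]
  exact integral_congr_ae (.of_forall hf)

theorem IsDualAction.norm_apply_le_of_mem_closure (hπ : S.IsDualAction π)
    (hcont : ∀ s, Continuous (π s)) (hf : ∀ s, f s = π s ω₀ φ) (a : K) {u : WeakDual ℂ X}
    (hu : u ∈ closure (Set.range fun s => π s ω₀)) : ‖π a u φ‖ ≤ ‖f‖ := by
  refine closure_minimal (Set.range_subset_iff.mpr fun s => ?_)
    (isClosed_le ((WeakDual.eval_continuous φ).comp (hcont a)).norm continuous_const) hu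
  change ‖π a (π s ω₀) φ‖ ≤ ‖f‖
  rw [← hπ.translate_apply hf]
  exact ((S.translate a f).norm_coe_le_norm s).trans (S.norm_translate_apply_le a f)

theorem IsDualAction.mem_AP (hπ : S.IsDualAction π) (hsep : IsSeparatelyContinuousAction π)
    (heq : IsEquicontinuousAction π) (hb : Bornology.IsBounded (Set.range fun s => π s ω₀))
    (hf : ∀ s, f s = π s ω₀ φ) : f ∈ S.AP := by
  let C := closure (Set.range fun s => π s ω₀)
  have hC : IsCompact C :=
    WeakDual.isCompact_of_bounded_of_closed (WeakDual.isBounded_closure hb) isClosed_closure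
  have : CompactSpace C := isCompact_iff_compactSpace.mp hC
  let F (a : K) : C →ᵇ ℂ := .mkOfCompact
    ⟨fun u => π a u φ, (WeakDual.eval_continuous φ).comp ((hsep.1 a).comp continuous_subtype_val)⟩
  have hF : TotallyBounded (Set.range F) := totallyBounded_range_of_equicontinuous
    (equicontinuous_coefficients heq hC φ) fun a u =>
      hπ.norm_apply_le_of_mem_closure hsep.1 hf a u.2
  let j : C(K, C) := ⟨fun s => ⟨π s ω₀, subset_closure ⟨s, rfl⟩⟩, (hsep.2 ω₀).subtype_mk _⟩
  have hFj (a : K) : S.translate a f = (F a).compContinuous j :=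
    DFunLike.ext _ _ fun s => hπ.translate_apply hf a s
  simp only [mem_AP_iff, hFj]
  have himage := hF.image
    (BoundedContinuousFunction.lipschitz_compContinuous (β := ℂ) j).uniformContinuous
  rwa [← Set.range_comp] at himage

end Orbits

theorem IsLeftAmenableAP.hasDualFixedPointProperty (hS : S.IsLeftAmenableAP) :
    S.HasDualFixedPointProperty X := by
  rintro π hπ hsep heq haff ⟨ω₀, hb⟩
  obtain ⟨m, hm, hinv⟩ := hS.exists_mean
  obtain ⟨R, hRpos, hR⟩ := exists_norm_apply_le_of_isBounded hb
  let c : X →L[ℂ] S.AP :=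
    (coefficientMap (fun s => π s ω₀) (hsep.2 ω₀) ⟨R, hRpos.le⟩ fun s => hR _ ⟨s, rfl⟩).codRestrict
      S.AP fun φ => hπ.mem_AP hsep heq hb (coefficientMap_apply _ _ φ)
  have hc (φ : X) (s : K) : (c φ : K →ᵇ ℂ) s = π s ω₀ φ := rfl
  refine ⟨StrongDual.toWeakDual (m ∘L c), fun a => DFunLike.ext _ _ fun φ => ?_⟩
  have hmid (u v : WeakDual ℂ X) :
      π a (((1 / 2 : ℝ) : ℂ) • u + ((1 / 2 : ℝ) : ℂ) • v) φ = (π a u φ + π a v φ) / 2 := by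
    rw [haff a u v (1 / 2) (1 / 2) (by norm_num) (by norm_num) (by norm_num)]
    change ((1 / 2 : ℝ) : ℂ) * π a u φ + ((1 / 2 : ℝ) : ℂ) * π a v φ = _
    push_cast
    ring
  calc π a (StrongDual.toWeakDual (m ∘L c)) φ = m (S.translateAP a (c φ)) :=
      hm.apply_eq_of_midpoint hc (G := fun u => π a u φ)
        ((WeakDual.eval_continuous φ).comp (hsep.1 a)) hmid (hπ.translate_apply (hc φ) a)
    _ = m (c φ) := hinv a (c φ)

end SemitopologicalSemihypergroup

theorem theorem3p5 {K : Type u} [TopologicalSpace K] [T2Space K] [LocallyCompactSpace K]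
    [Nonempty K] [MeasurableSpace K] [BorelSpace K] (S : SemitopologicalSemihypergroup K) :
    S.IsLeftAmenableAP ↔
      ∀ (X : Type (max u v)) [NormedAddCommGroup X] [NormedSpace ℂ X] [CompleteSpace X]
        (π : K → WeakDual ℂ X → WeakDual ℂ X),
        S.IsDualAction π → IsSeparatelyContinuousAction π → IsEquicontinuousAction π →
        IsAffineAction π →
        (∃ ω₀ : WeakDual ℂ X, Bornology.IsBounded (Set.range fun s : K => π s ω₀)) →
        ∃ x₀ : WeakDual ℂ X, ∀ s : K, π s x₀ = x₀ := by
  constructor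
  · intro hS X _ _ _
    exact hS.hasDualFixedPointProperty
  · intro h
    exact SemitopologicalSemihypergroup.isLeftAmenableAP_of_fixedPointProperty.{u, v} h
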